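/- Let $n,m\ge 0$ be integers, $d=n+m$, and let $\mathbf S_+^d$ be the set of real symmetric positive semidefinite $d\times d$ matrices. For a $d\times d$ matrix $P=\begin{bmatrix}P_{xx}&P_{xu}\\P_{ux}&P_{uu}\end{bmatrix}$ with $P_{xx}\in\mathbb R^{n\times n}$ put $\Pi(P)=P_{xx}-P_{xu}P_{uu}^{+}P_{ux}$, where $^{+}$ is the Moore–Penrose pseudoinverse. On a probability space $(\Omega,\mathcal F,\mathbb P)$ let $(A_t,N_t)$, $t=1,2,\dots$, be independent and identically distributed pairs of random matrices, $A_t\in\mathbb R^{n\times d}$, $N_t\in\mathbb R^{d\times d}$, with $N_t$ almost surely positive semidefinite. Assume that $\mathbb E\big[\|N_1\|_2^2+\|A_1^{\top}A_1\|_2^2\big]<\infty$, where $\|\cdot\|_2$ is the matrix $2$-norm (the operator norm), and that $\mathbb E[N_1]$ is positive definite. Let $(\alpha_t)_{t\ge0}$ be (possibly random) learning rates such that $\alpha_t$ is measurable with respect to $\sigma\{A_s,N_s:s=1,\dots,t\}$ (the trivial $\sigma$-algebra for $t=0$) and, almost surely, $\alpha_t\in[0,1]$ for all $t$, $\sum_{t\ge0}\alpha_t=\infty$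 and $\sum_{t\ge0}\alpha_t^2<\infty$. Let $Q_0\in\mathbf S_+^d$ be deterministic, and define the Q-learning sequence by $$Q_{t+1}=Q_t+\alpha_t\big(N_{t+1}+A_{t+1}^{\top}\,\Pi(Q_t)\,A_{t+1}-Q_t\big),\qquad t=0,1,2,\dots$$ Then the probability that $(Q_t)_{t\ge0}$ is bounded is either $0$ or $1$. If it is $1$, then $(Q_t)$ converges almost surely to a deterministic matrix $Q^\star\in\mathbf S_+^d$; if it is $0$, then $(Q_t)$ almost surely diverges, that is, has no limit in $\mathbb R^{d\times d}$. -/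

import Mathlib

open MeasureTheory ProbabilityTheory Filter Topology
open scoped Matrix Matrix.Norms.L2Operator

noncomputable section

namespace QLearningLQ

/-- The four Penrose equations: `X` is a Moore--Penrose pseudoinverse of the real matrix `M`. -/
structure IsMoorePenrose {p q : Type*} [Fintype p] [Fintype q]
    (M : Matrix p q ℝ) (X : Matrix q p ℝ) : Prop where
  mul_mul_left : M * X * M = M
  mul_mul_right : X * M * X = X
  symm_left : (M * X)ᵀ = M * X
  symm_right : (X * M)ᵀ = X * M

/-- The Moore--Penrose pseudoinverse is unique. -/
theorem IsMoorePenrose.eq {p q : Type*} [Fintype p] [Fintype q]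
    {M : Matrix p q ℝ} {X Y : Matrix q p ℝ}
    (hX : IsMoorePenrose M X) (hY : IsMoorePenrose M Y) : X = Y := by
  have h1 : M * X = M * Y := by
    calc M * X = (M * X)ᵀ := hX.symm_left.symm
      _ = ((M * Y) * (M * X))ᵀ := by
          rw [← Matrix.mul_assoc, hY.mul_mul_left]
      _ = (M * X) * (M * Y) := by
          rw [Matrix.transpose_mul, hX.symm_left, hY.symm_left]
      _ = M * Y := by rw [← Matrix.mul_assoc, hX.mul_mul_left]
  have h2 : X * M = Y * M := by
    calc X * M = (X * M)ᵀ := hX.symm_right.symm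
      _ = ((X * M) * (Y * M))ᵀ := by
          rw [Matrix.mul_assoc X M, ← Matrix.mul_assoc M, hY.mul_mul_left]
      _ = (Y * M) * (X * M) := by
          rw [Matrix.transpose_mul, hX.symm_right, hY.symm_right]
      _ = Y * M := by
          rw [Matrix.mul_assoc Y M, ← Matrix.mul_assoc M, hX.mul_mul_left]
  calc X = X * M * X := hX.mul_mul_right.symm
    _ = Y * M * X := by rw [h2]
    _ = Y * (M * X) := Matrix.mul_assoc _ _ _
    _ = Y * M * Y := by rw [h1, Matrix.mul_assoc]
    _ = Y := hY.mul_mul_right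

/-- A real symmetric matrix has a symmetric Moore--Penrose pseudoinverse. -/
theorem exists_isMoorePenrose_symm {p : Type*} [Fintype p] [DecidableEq p]
    (H : Matrix p p ℝ) (hH : H.IsHermitian) :
    ∃ X : Matrix p p ℝ, IsMoorePenrose H X ∧ Xᵀ = X := by
  obtain ⟨U, D, hU, hHD⟩ : ∃ (U : Matrix p p ℝ) (D : p → ℝ),
      Uᵀ * U = 1 ∧ H = U * Matrix.diagonal D * Uᵀ := by
    refine ⟨hH.eigenvectorUnitary, hH.eigenvalues, ?_, ?_⟩
    · have h := Unitary.coe_star_mul_self hH.eigenvectorUnitary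
      rwa [Matrix.star_eq_conjTranspose, Matrix.conjTranspose_eq_transpose_of_trivial] at h
    · have h := hH.spectral_theorem
      rw [Unitary.conjStarAlgAut_apply, Matrix.star_eq_conjTranspose,
        Matrix.conjTranspose_eq_transpose_of_trivial] at h
      exact h
  have key : ∀ E F : p → ℝ, (U * Matrix.diagonal E * Uᵀ) * (U * Matrix.diagonal F * Uᵀ)
      = U * Matrix.diagonal (fun i => E i * F i) * Uᵀ := by
    intro E F
    calc _ = U * Matrix.diagonal E * (Uᵀ * U) * Matrix.diagonal F * Uᵀ := by
          simp only [Matrix.mul_assoc]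
      _ = _ := by
          rw [hU, Matrix.mul_one, Matrix.mul_assoc U, Matrix.diagonal_mul_diagonal]
  have tr : ∀ E : p → ℝ, (U * Matrix.diagonal E * Uᵀ)ᵀ = U * Matrix.diagonal E * Uᵀ := by
    intro E
    simp [Matrix.transpose_mul, Matrix.mul_assoc]
  refine ⟨U * Matrix.diagonal (fun i => (D i)⁻¹) * Uᵀ, ⟨?_, ?_, ?_, ?_⟩, tr _⟩
  · rw [hHD, key, key]
    congr 3
    funext i
    simp
  · rw [hHD, key, key]
    congr 3
    funext i
    by_cases h : D i = 0 <;> simp [h]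
  · rw [hHD, key, tr]
  · rw [hHD, key, tr]

/-- Every real matrix has a Moore--Penrose pseudoinverse. -/
theorem exists_isMoorePenrose {p q : Type*} [Fintype p] [Fintype q]
    (M : Matrix p q ℝ) : ∃ X : Matrix q p ℝ, IsMoorePenrose M X := by
  classical
  have hH : (Mᵀ * M).IsHermitian := by
    rw [Matrix.IsHermitian, Matrix.conjTranspose_eq_transpose_of_trivial,
      Matrix.transpose_mul, Matrix.transpose_transpose]
  obtain ⟨Y, hY, hYs⟩ := exists_isMoorePenrose_symm (Mᵀ * M) hH
  have hM : M * (Y * (Mᵀ * M)) = M := by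
    have h : (M * (Y * (Mᵀ * M)) - M)ᵀ * (M * (Y * (Mᵀ * M)) - M) = 0 := by
      have e : (M * (Y * (Mᵀ * M)) - M)ᵀ * (M * (Y * (Mᵀ * M)) - M)
          = (Y * (Mᵀ * M))ᵀ * ((Mᵀ * M) * Y * (Mᵀ * M) - Mᵀ * M)
            - ((Mᵀ * M) * Y * (Mᵀ * M) - Mᵀ * M) := by
        simp only [Matrix.transpose_sub, Matrix.transpose_mul, Matrix.sub_mul, Matrix.mul_sub,
          Matrix.transpose_transpose, Matrix.mul_assoc]
        abel
      rw [e, hY.mul_mul_left]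
      simp
    have h' := (Matrix.conjTranspose_mul_self_eq_zero
      (A := M * (Y * (Mᵀ * M)) - M)).1 (by
        rwa [Matrix.conjTranspose_eq_transpose_of_trivial])
    exact sub_eq_zero.1 h'
  refine ⟨Y * Mᵀ, ⟨?_, ?_, ?_, ?_⟩⟩
  · simpa only [Matrix.mul_assoc] using hM
  · have h := congrArg (fun Z => Z * Mᵀ) hY.mul_mul_right
    simpa only [Matrix.mul_assoc] using h
  · simp only [Matrix.transpose_mul, Matrix.transpose_transpose, hYs, Matrix.mul_assoc]
  · have h := hY.symm_right
    simpa only [Matrix.mul_assoc] using h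

/-- The Moore--Penrose pseudoinverse `M⁺` of a real matrix. -/
def pinv {p q : Type*} [Fintype p] [Fintype q] (M : Matrix p q ℝ) : Matrix q p ℝ :=
  Classical.choose (exists_isMoorePenrose M)

/-- `pinv M` satisfies the Penrose equations. -/
theorem pinv_spec {p q : Type*} [Fintype p] [Fintype q] (M : Matrix p q ℝ) :
    IsMoorePenrose M (pinv M) :=
  Classical.choose_spec (exists_isMoorePenrose M)

/-- `Π(P) = P_xx - P_xu P_uu⁺ P_ux`, for a `d × d` matrix `P`, `d = n + m`, partitioned into the
blocks `P_xx` (`n × n`), `P_xu`, `P_ux` and `P_uu` (`m × m`). -/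
def ricPi {n m : ℕ} (P : Matrix (Fin n ⊕ Fin m) (Fin n ⊕ Fin m) ℝ) :
    Matrix (Fin n) (Fin n) ℝ :=
  P.toBlocks₁₁ - P.toBlocks₁₂ * pinv P.toBlocks₂₂ * P.toBlocks₂₁

/-- The Borel `σ`-algebra on real matrices, as the product `σ`-algebra of the entries. -/
instance instMeasurableSpaceMatrix {p q : Type*} : MeasurableSpace (Matrix p q ℝ) :=
  inferInstanceAs (MeasurableSpace (p → q → ℝ))

/-- The above is the Borel `σ`-algebra. -/
instance instBorelSpaceMatrix {p q : Type*} [Fintype p] [Fintype q] :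
    BorelSpace (Matrix p q ℝ) :=
  inferInstanceAs (BorelSpace (p → q → ℝ))

/-- `𝓕_t = σ{A_s, N_s : s = 1, …, t}`; it is trivial for `t = 0`. -/
@[reducible] def pastSigma {Ω : Type*} {n m : ℕ}
    (A : ℕ → Ω → Matrix (Fin n) (Fin n ⊕ Fin m) ℝ)
    (N : ℕ → Ω → Matrix (Fin n ⊕ Fin m) (Fin n ⊕ Fin m) ℝ) (t : ℕ) : MeasurableSpace Ω :=
  ⨆ s ∈ Finset.Icc 1 t,
    (MeasurableSpace.comap (A s) inferInstance ⊔ MeasurableSpace.comap (N s) inferInstance)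

/-- The Q-learning sequence with initial matrix `Q0` and learning rates `α`:
`Q_{t+1} = Q_t + α_t (N_{t+1} + A_{t+1}ᵀ Π(Q_t) A_{t+1} - Q_t)`.
The parameters are `A_t`, `N_t` with `t ≥ 1`; the values of `A` and `N` at `0` are not used. -/
def qSeq {Ω : Type*} {n m : ℕ}
    (A : ℕ → Ω → Matrix (Fin n) (Fin n ⊕ Fin m) ℝ)
    (N : ℕ → Ω → Matrix (Fin n ⊕ Fin m) (Fin n ⊕ Fin m) ℝ)
    (α : ℕ → Ω → ℝ) (Q0 : Matrix (Fin n ⊕ Fin m) (Fin n ⊕ Fin m) ℝ) :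
    ℕ → Ω → Matrix (Fin n ⊕ Fin m) (Fin n ⊕ Fin m) ℝ
  | 0, _ => Q0
  | t + 1, ω =>
      qSeq A N α Q0 t ω + α t ω •
        (N (t + 1) ω + (A (t + 1) ω)ᵀ * ricPi (qSeq A N α Q0 t ω) * A (t + 1) ω
          - qSeq A N α Q0 t ω)

/-- The expectation of a random matrix, taken entry by entry. -/
def matExp {Ω : Type*} [MeasurableSpace Ω] (μ : Measure Ω) {p q : Type*}
    (M : Ω → Matrix p q ℝ) : Matrix p q ℝ :=
  Matrix.of fun i j => ∫ ω, M ω i j ∂μ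

/-- The event that the sequence of random matrices `Q` is bounded. -/
def boundedEvent {Ω : Type*} {p : Type*} [Fintype p] [DecidableEq p]
    (Q : ℕ → Ω → Matrix p p ℝ) : Set Ω :=
  {ω | ∃ C : ℝ, ∀ t, ‖Q t ω‖ ≤ C}

end QLearningLQ

end

noncomputable section

namespace QLearningLQ

/-! Let `E = E[N]` and let `F(P) = E + E[Aᵀ Π(P) A]` be the mean map. `Π(P)` is the Loewner minimum
over `K` of `[1; K]ᵀ P [1; K]`, so `F` is monotone on positive semidefinite matrices, and `Π(cP) = c
Π(P)` gives `F(cP) = E + c (F(P) - E)`. Since `E` is positive definite, `F` contracts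
multiplicatively towards a fixed point. Whether a fixed point exists is a deterministic question,
and its answer decides the dichotomy; no tail-event argument is used.

The recursion reads `Q (t+1) = (1 - α) Q t + α F (Q t) + noise`. The noise may grow with `Q`, so it
is divided by the running maximum `m t` of the traces. As `Π(Q)` is bounded by the trace of `Q`, the
normalized noise has predictable weights at most `α t`, and its series converges almost surely by
`L²` martingale convergence, with no boundedness assumed (`IsModel.ae_tendsto_sum_normalizedNoise`).

The rest is pathwise. Subtracting the filtered noise turns the trajectory into an exact average
(`IsNoisyAverage.exists_filtered`). If some such path is bounded, it eventually dominates `(1 - ε)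
F^k(0)` for every `k`; the increasing value iteration is then bounded and its limit is a fixed point
(`IsRiccatiMap.exists_fixedPoint`). Conversely, a fixed point `P` confines every such path below a
multiple of `P`, and repeated squeezing between multiples of `P` forces convergence to `P`
(`IsRiccatiMap.tendsto_of_fixedPoint`). -/

/-! ### Almost sure convergence of martingale series. -/

/-- A predictable transform of centered `L²` innovations converges almost surely if the sum of the
squared weights is bounded. -/
theorem ae_tendsto_sum_mul_of_sum_sq_le {Ω : Type*} {m0 : MeasurableSpace Ω} {μ : Measure Ω}
    [IsProbabilityMeasure μ] (ℱ : Filtration ℕ m0) {V Y : ℕ → Ω → ℝ}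
    (hV : ∀ t, Measurable[ℱ t] (V t)) (hY : ∀ t, Measurable[ℱ (t + 1)] (Y t))
    (hind : ∀ t, Indep (MeasurableSpace.comap (Y t) inferInstance) (ℱ t) μ)
    (hL2 : ∀ t, MemLp (Y t) 2 μ) (hmean : ∀ t, ∫ ω, Y t ω ∂μ = 0)
    {v : ℝ} (hvar : ∀ t, ∫ ω, Y t ω ^ 2 ∂μ ≤ v) {K : ℝ}
    (hK : ∀ n ω, ∑ t ∈ Finset.range n, V t ω ^ 2 ≤ K) :
    ∀ᵐ ω ∂μ, ∃ l : ℝ,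
      Tendsto (fun n => ∑ t ∈ Finset.range n, V t ω * Y t ω) atTop (𝓝 l) := by
  have hVb : ∀ t ω, ‖V t ω‖ ≤ √K := fun t ω => by
    rw [Real.norm_eq_abs]
    refine Real.abs_le_sqrt (le_trans ?_ (hK (t + 1) ω))
    exact Finset.single_le_sum (f := fun s => V s ω ^ 2) (fun s _ => sq_nonneg _)
      (Finset.self_mem_range_succ t)
  have hV0 : ∀ t, Measurable (V t) := fun t => (hV t).mono (ℱ.le t) le_rfl
  have hY0 : ∀ t, Measurable (Y t) := fun t => (hY t).mono (ℱ.le _) le_rfl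
  have hVL : ∀ t, MemLp (V t) ⊤ μ := fun t =>
    memLp_top_of_bound (hV0 t).aestronglyMeasurable _ (ae_of_all _ (hVb t))
  have hVY : ∀ t, MemLp (fun ω => V t ω * Y t ω) 2 μ := fun t => (hL2 t).mul (hVL t)
  set M : ℕ → Ω → ℝ := fun n ω => ∑ t ∈ Finset.range n, V t ω * Y t ω with hM
  have hMS : ∀ n ω, M (n + 1) ω = M n ω + V n ω * Y n ω := fun n ω => Finset.sum_range_succ _ _
  have hM2 : ∀ n, MemLp (M n) 2 μ := fun n => memLp_finsetSum _ fun t _ => hVY t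
  have hMad : ∀ n, Measurable[ℱ n] (M n) := fun n =>
    Finset.measurable_fun_sum _ fun t ht => by
      have h := Finset.mem_range.1 ht
      exact ((hV t).mono (ℱ.mono h.le) le_rfl).mul ((hY t).mono (ℱ.mono h) le_rfl)
  have hindF : ∀ t (X : Ω → ℝ), Measurable[ℱ t] X → IndepFun X (Y t) μ := fun t X hX =>
    (indep_of_indep_of_le_right (hind t) hX.comap_le).symm
  have hmart : Martingale M ℱ μ := by
    refine martingale_nat (fun n => (hMad n).stronglyMeasurable)
      (fun n => (hM2 n).integrable one_le_two) fun n => ?_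
    have hYi : Integrable (Y n) μ := (hL2 n).integrable one_le_two
    have e1 : μ[fun ω => V n ω * Y n ω | ℱ n] =ᵐ[μ] 0 := by
      have h1 := condExp_stronglyMeasurable_mul_of_bound (ℱ.le n) (hV n).stronglyMeasurable hYi
        _ (ae_of_all μ (hVb n))
      have h2 := condExp_indep_eq (μ := μ) (f := Y n) ((hY0 n).comap_le) (ℱ.le n)
        (Measurable.stronglyMeasurable (comap_measurable (Y n))) (hind n)
      filter_upwards [h1, h2] with ω a b
      have : μ[fun ω => V n ω * Y n ω | ℱ n] ω = V n ω * μ[Y n | ℱ n] ω := a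
      rw [this, b, hmean n, mul_zero]
      rfl
    have e2 : μ[M (n + 1) | ℱ n] =ᵐ[μ] μ[M n | ℱ n] + μ[fun ω => V n ω * Y n ω | ℱ n] := by
      have : M (n + 1) = M n + fun ω => V n ω * Y n ω := funext (hMS n)
      rw [this]
      exact condExp_add ((hM2 n).integrable one_le_two) ((hVY n).integrable one_le_two) _
    have e3 : μ[M n | ℱ n] = M n := condExp_of_stronglyMeasurable (ℱ.le n)
      (hMad n).stronglyMeasurable ((hM2 n).integrable one_le_two)
    filter_upwards [e1, e2] with ω a b
    rw [b, Pi.add_apply, a, e3]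
    simp
  have hVsq : ∀ t, Integrable (fun ω => V t ω ^ 2) μ := fun t =>
    ((hVL t).mono_exponent le_top : MemLp (V t) 2 μ).integrable_sq
  -- Orthogonality of increments: independence kills the cross term and factors the square term, so
  -- the second moments add up.
  have hsq : ∀ n, ∫ ω, M n ω ^ 2 ∂μ ≤ v * ∫ ω, ∑ t ∈ Finset.range n, V t ω ^ 2 ∂μ := by
    intro n
    induction n with
    | zero => simp [hM]
    | succ n ih =>
      have hMV : MemLp (fun ω => M n ω * V n ω) 2 μ := (hVL n).mul (hM2 n)
      have i1 : Integrable (fun ω => M n ω ^ 2) μ := (hM2 n).integrable_sq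
      have i2 : Integrable (fun ω => (M n ω * V n ω) * Y n ω) μ :=
        memLp_one_iff_integrable.1 ((hL2 n).mul hMV)
      have i3 : Integrable (fun ω => V n ω ^ 2 * Y n ω ^ 2) μ := by
        simpa only [mul_pow] using (hVY n).integrable_sq
      have c2 : ∫ ω, (M n ω * V n ω) * Y n ω ∂μ = 0 := by
        have h := (hindF n (fun ω => M n ω * V n ω)
          ((hMad n).mul (hV n))).integral_fun_mul_eq_mul_integral
          hMV.aestronglyMeasurable (hL2 n).aestronglyMeasurable
        rw [h, hmean, mul_zero]
      have c3 : ∫ ω, V n ω ^ 2 * Y n ω ^ 2 ∂μ = (∫ ω, V n ω ^ 2 ∂μ) * ∫ ω, Y n ω ^ 2 ∂μ := by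
        have h := (hindF n (V n) (hV n)).comp (φ := fun x : ℝ => x ^ 2) (ψ := fun x : ℝ => x ^ 2)
          (by fun_prop) (by fun_prop)
        exact h.integral_fun_mul_eq_mul_integral (hVsq n).aestronglyMeasurable
          (hL2 n).integrable_sq.aestronglyMeasurable
      have e : ∀ ω, M (n + 1) ω ^ 2
          = M n ω ^ 2 + 2 * ((M n ω * V n ω) * Y n ω) + V n ω ^ 2 * Y n ω ^ 2 := fun ω => by
        rw [hMS]; ring
      have hL : ∫ ω, M (n + 1) ω ^ 2 ∂μ
          = (∫ ω, M n ω ^ 2 ∂μ) + (∫ ω, V n ω ^ 2 ∂μ) * ∫ ω, Y n ω ^ 2 ∂μ := by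
        simp_rw [e]
        have i12 : Integrable (fun ω => M n ω ^ 2 + 2 * ((M n ω * V n ω) * Y n ω)) μ :=
          i1.add (i2.const_mul 2)
        rw [integral_add i12 i3, integral_add i1 (i2.const_mul 2),
          integral_const_mul, c2, c3]
        ring
      have hR : ∫ ω, ∑ t ∈ Finset.range (n + 1), V t ω ^ 2 ∂μ
          = (∫ ω, ∑ t ∈ Finset.range n, V t ω ^ 2 ∂μ) + ∫ ω, V n ω ^ 2 ∂μ := by
        simp_rw [Finset.sum_range_succ]
        exact integral_add (integrable_finsetSum _ fun t _ => hVsq t) (hVsq n)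
      rw [hL, hR]
      have := mul_le_mul_of_nonneg_left (hvar n)
        (integral_nonneg fun ω => sq_nonneg (V n ω) : 0 ≤ ∫ ω, V n ω ^ 2 ∂μ)
      linarith
  have hv : 0 ≤ v := le_trans (integral_nonneg fun ω => sq_nonneg (Y 0 ω)) (hvar 0)
  have hbd : ∀ n, eLpNorm (M n) 1 μ ≤ (Real.toNNReal (√(v * K)) : ENNReal) := by
    intro n
    refine le_trans (eLpNorm_le_eLpNorm_of_exponent_le one_le_two
      (hM2 n).aestronglyMeasurable) ?_
    have h2 := (hM2 n).eLpNorm_eq_integral_rpow_norm (by norm_num) (by norm_num)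
    rw [h2]
    refine ENNReal.coe_le_coe.2 (Real.toNNReal_le_toNNReal ?_)
    have : ∫ ω, ‖M n ω‖ ^ (ENNReal.toReal 2) ∂μ = ∫ ω, M n ω ^ 2 ∂μ := by
      refine integral_congr_ae (ae_of_all _ fun ω => ?_)
      simp
    rw [this, Real.sqrt_eq_rpow]
    have hi : ∫ ω, ∑ t ∈ Finset.range n, V t ω ^ 2 ∂μ ≤ K := by
      calc _ ≤ ∫ _, K ∂μ := integral_mono (integrable_finsetSum _ fun t _ => hVsq t)
            (integrable_const _) (hK n)
        _ = K := by simp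
    have h0 : 0 ≤ ∫ ω, M n ω ^ 2 ∂μ := integral_nonneg fun ω => sq_nonneg _
    norm_num
    exact Real.rpow_le_rpow h0 ((hsq n).trans (mul_le_mul_of_nonneg_left hi hv)) (by norm_num)
  exact hmart.submartingale.exists_ae_tendsto_of_bdd hbd

/-- A predictable transform of centered `L²` innovations converges almost surely if the weights
are almost surely square summable. -/
theorem ae_tendsto_sum_mul_of_summable_sq {Ω : Type*} {m0 : MeasurableSpace Ω} {μ : Measure Ω}
    [IsProbabilityMeasure μ] (ℱ : Filtration ℕ m0) {W Y : ℕ → Ω → ℝ}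
    (hW : ∀ t, Measurable[ℱ t] (W t)) (hY : ∀ t, Measurable[ℱ (t + 1)] (Y t))
    (hind : ∀ t, Indep (MeasurableSpace.comap (Y t) inferInstance) (ℱ t) μ)
    (hL2 : ∀ t, MemLp (Y t) 2 μ) (hmean : ∀ t, ∫ ω, Y t ω ∂μ = 0)
    {v : ℝ} (hvar : ∀ t, ∫ ω, Y t ω ^ 2 ∂μ ≤ v)
    (hsum : ∀ᵐ ω ∂μ, Summable fun t => W t ω ^ 2) :
    ∀ᵐ ω ∂μ, ∃ l : ℝ,
      Tendsto (fun n => ∑ t ∈ Finset.range n, W t ω * Y t ω) atTop (𝓝 l) := by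
  classical
  -- Localization: the weight is switched off once the sum of squares, including the current term,
  -- exceeds `K`. This is still predictable, because `W t` is known at time `t` while `Y t` is
  -- revealed at `t + 1`.
  set V : ℕ → ℕ → Ω → ℝ := fun K t ω =>
    if ∑ s ∈ Finset.range (t + 1), W s ω ^ 2 ≤ K then W t ω else 0 with hVdef
  have hV : ∀ K t, Measurable[ℱ t] (V K t) := fun K t => by
    refine Measurable.ite ?_ (hW t) measurable_const
    have : Measurable[ℱ t] fun ω => ∑ s ∈ Finset.range (t + 1), W s ω ^ 2 :=
      Finset.measurable_fun_sum _ fun s hs =>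
        ((hW s).mono (ℱ.mono (Nat.lt_succ_iff.1 (Finset.mem_range.1 hs))) le_rfl).pow_const 2
    exact measurableSet_le this measurable_const
  have hVK : ∀ (K : ℕ) n ω, ∑ t ∈ Finset.range n, V K t ω ^ 2 ≤ K := by
    intro K n ω
    have key : ∑ t ∈ Finset.range n, V K t ω ^ 2 ≤ K ∧
        (∑ t ∈ Finset.range n, V K t ω ^ 2 ≤ ∑ t ∈ Finset.range n, W t ω ^ 2) := by
      induction n with
      | zero => simp
      | succ n ih =>
        rw [Finset.sum_range_succ, Finset.sum_range_succ]
        by_cases h : ∑ s ∈ Finset.range (n + 1), W s ω ^ 2 ≤ K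
        · have e : V K n ω = W n ω := if_pos h
          rw [Finset.sum_range_succ] at h
          rw [e]
          constructor <;> linarith [ih.2]
        · have e : V K n ω = 0 := if_neg h
          rw [e]
          constructor <;> nlinarith [ih.1, ih.2, sq_nonneg (W n ω)]
    exact key.1
  have hall : ∀ᵐ ω ∂μ, ∀ K : ℕ, ∃ l : ℝ,
      Tendsto (fun n => ∑ t ∈ Finset.range n, V K t ω * Y t ω) atTop (𝓝 l) :=
    ae_all_iff.2 fun K => ae_tendsto_sum_mul_of_sum_sq_le ℱ (hV K) hY hind hL2 hmean hvar (hVK K)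
  filter_upwards [hall, hsum] with ω h hs
  obtain ⟨K, hK⟩ := exists_nat_ge (∑' t, W t ω ^ 2)
  obtain ⟨l, hl⟩ := h K
  refine ⟨l, hl.congr fun n => Finset.sum_congr rfl fun t _ => ?_⟩
  have : V K t ω = W t ω := if_pos
    ((hs.sum_le_tsum _ fun s _ => sq_nonneg (W s ω)).trans hK)
  rw [this]

/-! ### Entries and traces of positive semidefinite matrices. -/

theorem posSemidef_transpose_mul_self {p q : Type*} [Fintype p] [Fintype q] (B : Matrix p q ℝ) :
    (Bᵀ * B).PosSemidef := by
  have := Matrix.posSemidef_conjTranspose_mul_self B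
  rwa [Matrix.conjTranspose_eq_transpose_of_trivial] at this

theorem apply_le_trace {p : Type*} [Fintype p] {X : Matrix p p ℝ} (hX : X.PosSemidef) (i : p) :
    X i i ≤ X.trace :=
  Finset.single_le_sum (f := fun i => X i i) (fun _ _ => hX.diag_nonneg) (Finset.mem_univ i)

/-- Testing the quadratic form on `e_i ± e_j` bounds `2 |X i j|` by `X i i + X j j`. The trace
thereby controls all entries. -/
theorem abs_apply_le_trace {p : Type*} [Fintype p] {X : Matrix p p ℝ} (hX : X.PosSemidef)
    (i j : p) : |X i j| ≤ X.trace := by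
  classical
  have hs : X j i = X i j := by simpa using hX.1.apply i j
  have hi := apply_le_trace hX i
  have hj := apply_le_trace hX j
  have h1 := hX.dotProduct_mulVec_nonneg (Pi.single i 1 + Pi.single j 1)
  have h2 := hX.dotProduct_mulVec_nonneg (Pi.single i 1 - Pi.single j 1)
  simp [Matrix.mulVec_add, Matrix.mulVec_sub, hs] at h1 h2
  rw [abs_le]
  constructor <;> linarith

/-! ### Algebra of the pseudoinverse. -/

section Pseudoinverse

variable {p q : Type*} [Fintype p] [Fintype q]

theorem transpose_pinv_of_symm {H : Matrix p p ℝ} (hH : Hᵀ = H) : (pinv H)ᵀ = pinv H := by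
  have h := pinv_spec H
  refine IsMoorePenrose.eq (M := H) ⟨?_, ?_, ?_, ?_⟩ h
  · have := congrArg Matrix.transpose h.mul_mul_left
    simpa [Matrix.transpose_mul, hH, Matrix.mul_assoc] using this
  · have := congrArg Matrix.transpose h.mul_mul_right
    simpa [Matrix.transpose_mul, hH, Matrix.mul_assoc] using this
  · have := h.symm_right
    rw [Matrix.transpose_mul, hH] at this
    rw [Matrix.transpose_mul, Matrix.transpose_transpose, hH, this]
  · have := h.symm_left
    rw [Matrix.transpose_mul, hH] at this
    rw [Matrix.transpose_mul, Matrix.transpose_transpose, hH, this]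

theorem pinv_smul {c : ℝ} (hc : c ≠ 0) (M : Matrix p q ℝ) : pinv (c • M) = c⁻¹ • pinv M := by
  have h := pinv_spec M
  have e1 : c • M * c⁻¹ • pinv M = M * pinv M := by
    rw [Matrix.smul_mul, Matrix.mul_smul, smul_smul, mul_inv_cancel₀ hc, one_smul]
  have e2 : c⁻¹ • pinv M * c • M = pinv M * M := by
    rw [Matrix.smul_mul, Matrix.mul_smul, smul_smul, inv_mul_cancel₀ hc, one_smul]
  refine (pinv_spec (c • M)).eq ⟨?_, ?_, ?_, ?_⟩
  · rw [e1, Matrix.mul_smul, h.mul_mul_left]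
  · rw [e2, Matrix.mul_smul, h.mul_mul_right]
  · rw [e1, h.symm_left]
  · rw [e2, h.symm_right]

/-- `B (BᵀB)⁺ Bᵀ B = B`. -/
theorem mul_pinv_gram (B : Matrix p q ℝ) : B * pinv (Bᵀ * B) * Bᵀ * B = B := by
  classical
  have hH : (Bᵀ * B)ᵀ = Bᵀ * B := by simp [Matrix.transpose_mul]
  have h := pinv_spec (Bᵀ * B)
  set X := pinv (Bᵀ * B)
  set D := B * X * Bᵀ * B - B with hD
  -- `D` has its columns in the range of `B` and is orthogonal to that range, hence vanishes.
  have h0 : Bᵀ * D = 0 := by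
    have := h.mul_mul_left
    simp only [Matrix.mul_assoc] at this
    simp only [hD, Matrix.mul_sub, Matrix.mul_assoc, this, sub_self]
  have h1 : Dᵀ * D = 0 := by
    have : Dᵀ = (X * Bᵀ * B - 1 : Matrix q q ℝ)ᵀ * Bᵀ := by
      rw [← Matrix.transpose_mul, Matrix.mul_sub, Matrix.mul_one, hD]
      simp only [Matrix.mul_assoc]
    rw [this, Matrix.mul_assoc, h0, Matrix.mul_zero]
  have h2 : D = 0 := (Matrix.conjTranspose_mul_self_eq_zero (A := D)).1 (by
    rwa [Matrix.conjTranspose_eq_transpose_of_trivial])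
  exact sub_eq_zero.1 h2

end Pseudoinverse

/-! ### The generalized Schur complement `Π` as a minimum over gains. -/

section Schur

variable {n m : ℕ}

/-- The block column `[1; K]`. -/
def gainCol (K : Matrix (Fin m) (Fin n) ℝ) : Matrix (Fin n ⊕ Fin m) (Fin n) ℝ :=
  Matrix.fromRows 1 K

/-- Splitting the columns of a square factor `S` of `P = Sᵀ S`. In Gram form the cross block
automatically satisfies the range condition that the pseudoinverse formula needs. -/
theorem exists_blocks_of_posSemidef {P : Matrix (Fin n ⊕ Fin m) (Fin n ⊕ Fin m) ℝ}
    (hP : P.PosSemidef) :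
    ∃ (B : Matrix (Fin n ⊕ Fin m) (Fin n) ℝ) (D : Matrix (Fin n ⊕ Fin m) (Fin m) ℝ),
      P = Matrix.fromBlocks (Bᵀ * B) (Bᵀ * D) (Dᵀ * B) (Dᵀ * D) := by
  open scoped MatrixOrder in
  obtain ⟨S, hS⟩ := CStarAlgebra.nonneg_iff_eq_star_mul_self.1
    (Matrix.nonneg_iff_posSemidef.2 hP)
  rw [Matrix.star_eq_conjTranspose, Matrix.conjTranspose_eq_transpose_of_trivial] at hS
  refine ⟨S.toCols₁, S.toCols₂, ?_⟩
  rw [hS]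
  conv_lhs => rw [← Matrix.fromCols_toCols S]
  rw [Matrix.transpose_fromCols, Matrix.fromRows_mul_fromCols]

/-- For a Gram matrix of block columns `B`, `D`, `Π` is the Gram matrix of the projection of `B`
onto the orthogonal complement of the range of `D`. -/
theorem ricPi_gram (B : Matrix (Fin n ⊕ Fin m) (Fin n) ℝ) (D : Matrix (Fin n ⊕ Fin m) (Fin m) ℝ) :
    ∃ E : Matrix (Fin n ⊕ Fin m) (Fin n ⊕ Fin m) ℝ, Eᵀ = E ∧ E * E = E ∧ E * D = D ∧
      ricPi (Matrix.fromBlocks (Bᵀ * B) (Bᵀ * D) (Dᵀ * B) (Dᵀ * D))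
        = ((1 - E) * B)ᵀ * ((1 - E) * B) ∧
      (∃ K : Matrix (Fin m) (Fin n) ℝ, (1 - E) * B = B + D * K) := by
  have hH : (Dᵀ * D)ᵀ = Dᵀ * D := by simp [Matrix.transpose_mul]
  have hE1 : (D * pinv (Dᵀ * D) * Dᵀ)ᵀ = D * pinv (Dᵀ * D) * Dᵀ := by
    simp only [Matrix.transpose_mul, Matrix.transpose_transpose, transpose_pinv_of_symm hH,
      Matrix.mul_assoc]
  have hE3 : D * pinv (Dᵀ * D) * Dᵀ * D = D := mul_pinv_gram D
  have hE2 : (D * pinv (Dᵀ * D) * Dᵀ) * (D * pinv (Dᵀ * D) * Dᵀ) = D * pinv (Dᵀ * D) * Dᵀ := by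
    rw [← Matrix.mul_assoc, ← Matrix.mul_assoc, hE3]
  -- `E` is the orthogonal projection onto the range of `D`; the gain is the least squares solution
  -- of `B + D K ≈ 0`.
  refine ⟨D * pinv (Dᵀ * D) * Dᵀ, hE1, hE2, hE3, ?_, -(pinv (Dᵀ * D) * Dᵀ * B), ?_⟩
  · have e : (1 - D * pinv (Dᵀ * D) * Dᵀ) * (1 - D * pinv (Dᵀ * D) * Dᵀ)
        = 1 - D * pinv (Dᵀ * D) * Dᵀ := by
      rw [Matrix.sub_mul, Matrix.mul_sub, Matrix.mul_sub, hE2]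
      simp
    rw [Matrix.transpose_mul, Matrix.transpose_sub, hE1, Matrix.transpose_one,
      Matrix.mul_assoc, ← Matrix.mul_assoc (1 - _) (1 - _), e, ricPi]
    simp only [Matrix.toBlocks_fromBlocks₁₁, Matrix.toBlocks_fromBlocks₁₂,
      Matrix.toBlocks_fromBlocks₂₁, Matrix.toBlocks_fromBlocks₂₂, Matrix.sub_mul, Matrix.mul_sub,
      Matrix.one_mul, Matrix.mul_assoc]
  · rw [Matrix.sub_mul, Matrix.one_mul, Matrix.mul_neg, sub_eq_add_neg]
    simp only [Matrix.mul_assoc]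

theorem gain_gram (B : Matrix (Fin n ⊕ Fin m) (Fin n) ℝ) (D : Matrix (Fin n ⊕ Fin m) (Fin m) ℝ)
    (K : Matrix (Fin m) (Fin n) ℝ) :
    (gainCol K)ᵀ * Matrix.fromBlocks (Bᵀ * B) (Bᵀ * D) (Dᵀ * B) (Dᵀ * D) * gainCol K
      = (B + D * K)ᵀ * (B + D * K) := by
  have h : Matrix.fromBlocks (Bᵀ * B) (Bᵀ * D) (Dᵀ * B) (Dᵀ * D)
      = (Matrix.fromCols B D)ᵀ * Matrix.fromCols B D := by
    rw [Matrix.transpose_fromCols, Matrix.fromRows_mul_fromCols]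
  have h2 : Matrix.fromCols B D * gainCol K = B + D * K := by
    rw [gainCol, Matrix.fromCols_mul_fromRows, Matrix.mul_one]
  rw [h, ← h2, Matrix.transpose_mul]
  simp only [Matrix.mul_assoc]

theorem posSemidef_ricPi {P : Matrix (Fin n ⊕ Fin m) (Fin n ⊕ Fin m) ℝ} (hP : P.PosSemidef) :
    (ricPi P).PosSemidef := by
  obtain ⟨B, D, rfl⟩ := exists_blocks_of_posSemidef hP
  obtain ⟨E, -, -, -, h, -⟩ := ricPi_gram B D
  rw [h]
  exact posSemidef_transpose_mul_self _

theorem exists_gain_ricPi {P : Matrix (Fin n ⊕ Fin m) (Fin n ⊕ Fin m) ℝ} (hP : P.PosSemidef) :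
    ∃ K : Matrix (Fin m) (Fin n) ℝ, ricPi P = (gainCol K)ᵀ * P * gainCol K := by
  obtain ⟨B, D, rfl⟩ := exists_blocks_of_posSemidef hP
  obtain ⟨E, -, -, -, h, K, hK⟩ := ricPi_gram B D
  exact ⟨K, by rw [h, gain_gram, hK]⟩

-- Pythagoras: `B + D K` splits into `(1 - E) B`, independent of `K`, and its component in the range
-- of `D`, whose Gram matrix is the excess.
open scoped MatrixOrder in
theorem ricPi_le_gain {P : Matrix (Fin n ⊕ Fin m) (Fin n ⊕ Fin m) ℝ} (hP : P.PosSemidef)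
    (K : Matrix (Fin m) (Fin n) ℝ) : ricPi P ≤ (gainCol K)ᵀ * P * gainCol K := by
  obtain ⟨B, D, rfl⟩ := exists_blocks_of_posSemidef hP
  obtain ⟨E, hE1, hE2, hE3, h, -⟩ := ricPi_gram B D
  rw [h, gain_gram, Matrix.le_iff]
  have e : (B + D * K)ᵀ * (B + D * K) - ((1 - E) * B)ᵀ * ((1 - E) * B)
      = (E * (B + D * K))ᵀ * (E * (B + D * K)) := by
    set G := B + D * K with hG
    have h1 : (1 - E) * B = (1 - E) * G := by
      rw [hG, Matrix.mul_add, ← Matrix.mul_assoc, Matrix.sub_mul 1 E D, hE3]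
      simp
    rw [h1]
    simp only [Matrix.transpose_mul, Matrix.transpose_sub, hE1, Matrix.transpose_one]
    have h2 : Gᵀ * (1 - E) * ((1 - E) * G) = Gᵀ * ((1 - E) * (1 - E)) * G := by
      simp only [Matrix.mul_assoc]
    have h3 : Gᵀ * E * (E * G) = Gᵀ * (E * E) * G := by simp only [Matrix.mul_assoc]
    have h4 : (1 - E) * (1 - E) = 1 - E := by
      rw [Matrix.sub_mul, Matrix.mul_sub, Matrix.mul_sub, hE2]
      simp
    rw [h2, h3, h4, hE2, Matrix.mul_sub, Matrix.sub_mul]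
    simp
  rw [e]
  exact posSemidef_transpose_mul_self _

-- A minimum of monotone maps is monotone: the gain optimal for `P'` is a competitor for `P`.
open scoped MatrixOrder in
theorem ricPi_mono {P P' : Matrix (Fin n ⊕ Fin m) (Fin n ⊕ Fin m) ℝ} (hP : P.PosSemidef)
    (h : P ≤ P') : ricPi P ≤ ricPi P' := by
  have hP' : P'.PosSemidef := Matrix.nonneg_iff_posSemidef.1
    ((Matrix.nonneg_iff_posSemidef.2 hP).trans h)
  obtain ⟨K, hK⟩ := exists_gain_ricPi hP'
  refine (ricPi_le_gain hP K).trans ?_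
  rw [hK, Matrix.le_iff, ← Matrix.sub_mul, ← Matrix.mul_sub]
  have := (Matrix.le_iff.1 h).conjTranspose_mul_mul_same (gainCol K)
  rwa [Matrix.conjTranspose_eq_transpose_of_trivial] at this

theorem ricPi_smul {c : ℝ} (P : Matrix (Fin n ⊕ Fin m) (Fin n ⊕ Fin m) ℝ) :
    ricPi (c • P) = c • ricPi P := by
  have e1 : (c • P).toBlocks₁₁ = c • P.toBlocks₁₁ := rfl
  have e2 : (c • P).toBlocks₁₂ = c • P.toBlocks₁₂ := rfl
  have e3 : (c • P).toBlocks₂₁ = c • P.toBlocks₂₁ := rfl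
  have e4 : (c • P).toBlocks₂₂ = c • P.toBlocks₂₂ := rfl
  rw [ricPi, ricPi, e1, e2, e3, e4]
  by_cases hc : c = 0
  · simp [hc]
  · rw [pinv_smul hc]
    simp only [Matrix.smul_mul, Matrix.mul_smul, smul_smul, smul_sub]
    congr 2
    field_simp

/-- The zero gain yields `Π(P) ≤ P_xx`. This is what lets the running trace dominate the noise
coefficients. -/
theorem trace_ricPi_le {P : Matrix (Fin n ⊕ Fin m) (Fin n ⊕ Fin m) ℝ} (hP : P.PosSemidef) :
    (ricPi P).trace ≤ P.trace := by
  have h := (Matrix.le_iff.1 (ricPi_le_gain hP (0 : Matrix (Fin m) (Fin n) ℝ))).trace_nonneg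
  have e : (gainCol (0 : Matrix (Fin m) (Fin n) ℝ))ᵀ * P *
      gainCol (0 : Matrix (Fin m) (Fin n) ℝ) = P.toBlocks₁₁ := by
    conv_lhs => rw [← Matrix.fromBlocks_toBlocks P]
    rw [gainCol, Matrix.transpose_fromRows, Matrix.fromCols_mul_fromBlocks,
      Matrix.fromCols_mul_fromRows]
    simp
  rw [e, Matrix.trace_sub] at h
  have h2 : P.trace = P.toBlocks₁₁.trace + P.toBlocks₂₂.trace := by
    simp [Matrix.trace, Fintype.sum_sum_type, Matrix.toBlocks₁₁, Matrix.toBlocks₂₂]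
  have h3 : 0 ≤ P.toBlocks₂₂.trace := (hP.submatrix Sum.inr).trace_nonneg
  linarith

end Schur

/-! ### Measurability of the pseudoinverse and of `Π`. -/

section Measurability

instance instSecondCountableTopologyMatrix {p q : Type*} [Fintype p] [Fintype q] :
    SecondCountableTopology (Matrix p q ℝ) :=
  inferInstanceAs (SecondCountableTopology (p → q → ℝ))

theorem measurable_matrix_mul {p q r : Type*} [Fintype p] [Fintype q] [Fintype r] :
    Measurable fun x : Matrix p q ℝ × Matrix q r ℝ => x.1 * x.2 :=
  (continuous_fst.matrix_mul continuous_snd).measurable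

theorem measurable_matrix_inv {p : Type*} [Fintype p] [DecidableEq p] :
    Measurable fun M : Matrix p p ℝ => M⁻¹ := by
  have : (fun M : Matrix p p ℝ => M⁻¹) = fun M => (M.det)⁻¹ • M.adjugate := by
    funext M
    rw [Matrix.inv_def, Ring.inverse_eq_inv']
  rw [this]
  have h1 : Measurable fun M : Matrix p p ℝ => M.det := continuous_id.matrix_det.measurable
  have h2 : Measurable fun M : Matrix p p ℝ => M.adjugate :=
    continuous_id.matrix_adjugate.measurable
  have h3 : Measurable fun x : ℝ × Matrix p p ℝ => x.1 • x.2 :=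
    (continuous_fst.smul continuous_snd).measurable
  exact h3.comp (h1.inv.prodMk h2)

/-- The pseudoinverse is discontinuous in general, so measurability comes from a pointwise limit of
Tikhonov regularizations. With `G = Mᵀ M`, `Mᵀ = G X` and `X = G Y`, two applications of `J G = 1 -
e J` give the error `e (e J Y - Y)`, which is `O(e)` since `0 ≤ e J ≤ 1`. -/
theorem tendsto_regularized_pinv {p q : Type*} [Fintype p] [Fintype q] [DecidableEq q]
    (M : Matrix p q ℝ) :
    Tendsto (fun k : ℕ => (Mᵀ * M + (1 / ((k : ℝ) + 1)) • (1 : Matrix q q ℝ))⁻¹ * Mᵀ) atTop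
      (𝓝 (pinv M)) := by
  set X := pinv M with hX
  set Y := X * Xᵀ * X with hY
  set G := Mᵀ * M with hG
  have h := pinv_spec M
  have hM : Mᵀ = G * X := by
    have := congrArg Matrix.transpose h.mul_mul_left
    rw [Matrix.transpose_mul, h.symm_left, ← Matrix.mul_assoc] at this
    exact this.symm
  have hXY : X = G * Y := by
    have h1 : X * M * X = Mᵀ * Xᵀ * X := by rw [← h.symm_right, Matrix.transpose_mul]
    rw [h.mul_mul_right] at h1
    have h2 : G * Y = G * X * Xᵀ * X := by rw [hY]; simp only [Matrix.mul_assoc]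
    rw [h2, ← hM, ← h1]
  have hGp : G.PosSemidef := posSemidef_transpose_mul_self M
  have hGt : Gᵀ = G := by simp [hG, Matrix.transpose_mul]
  have key : ∀ e : ℝ, 0 < e → ∀ i j,
      |((G + e • (1 : Matrix q q ℝ))⁻¹ * Mᵀ - X) i j|
        ≤ e * (|Y i j| + ∑ k, (1 : Matrix q q ℝ).trace * |Y k j|) := by
    intro e he i j
    have hpd : (G + e • (1 : Matrix q q ℝ)).PosDef :=
      Matrix.PosDef.posSemidef_add hGp (Matrix.PosDef.one.smul he)
    have hu : IsUnit (G + e • (1 : Matrix q q ℝ)).det :=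
      (Matrix.isUnit_iff_isUnit_det _).1 hpd.isUnit
    set J := (G + e • (1 : Matrix q q ℝ))⁻¹ with hJ
    have hJp : J.PosSemidef := hpd.inv.posSemidef
    have hJt : Jᵀ = J := by
      have := hJp.1
      rwa [Matrix.IsHermitian, Matrix.conjTranspose_eq_transpose_of_trivial] at this
    have hJl : J * G + e • J = 1 := by
      have := Matrix.nonsing_inv_mul _ hu
      rwa [Matrix.mul_add, Matrix.mul_smul, Matrix.mul_one] at this
    have hJr : G * J + e • J = 1 := by
      have := Matrix.mul_nonsing_inv _ hu
      rwa [Matrix.add_mul, Matrix.smul_mul, Matrix.one_mul] at this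
    have hcontr : (1 - e • J).PosSemidef := by
      have h1 : (1 - e • J : Matrix q q ℝ) = (G * J)ᵀ * (G * J) + e • (Jᵀ * G * J) := by
        have : (G * J)ᵀ * (G * J) + e • (Jᵀ * G * J) = (J * G) * (G * J + e • J) := by
          rw [Matrix.transpose_mul, hGt, hJt, Matrix.mul_add, Matrix.mul_smul]
        rw [this, hJr, Matrix.mul_one, eq_sub_of_add_eq hJl]
      rw [h1]
      refine (posSemidef_transpose_mul_self _).add (Matrix.PosSemidef.smul ?_ he.le)
      have := hGp.conjTranspose_mul_mul_same J
      rwa [Matrix.conjTranspose_eq_transpose_of_trivial] at this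
    have htr : (e • J).trace ≤ (1 : Matrix q q ℝ).trace := by
      have := hcontr.trace_nonneg
      rw [Matrix.trace_sub] at this
      linarith
    have h3 : J * Mᵀ - X = e • (e • J * Y - Y) := by
      have a1 : J * Mᵀ = X - e • (J * X) := by
        rw [hM, ← Matrix.mul_assoc, eq_sub_of_add_eq hJl, Matrix.sub_mul, Matrix.one_mul,
          Matrix.smul_mul]
      have a2 : J * X = Y - e • J * Y := by
        conv_lhs => rw [hXY]
        rw [← Matrix.mul_assoc, eq_sub_of_add_eq hJl, Matrix.sub_mul, Matrix.one_mul]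
      rw [a1, a2, smul_sub, smul_sub]
      abel
    rw [h3, Matrix.smul_apply, smul_eq_mul, abs_mul, abs_of_pos he]
    refine mul_le_mul_of_nonneg_left ?_ he.le
    rw [Matrix.sub_apply, add_comm]
    refine (abs_sub _ _).trans (add_le_add_left ?_ _)
    rw [Matrix.mul_apply]
    refine (Finset.abs_sum_le_sum_abs _ _).trans (Finset.sum_le_sum fun k _ => ?_)
    rw [abs_mul]
    exact mul_le_mul_of_nonneg_right
      ((abs_apply_le_trace (hJp.smul he.le) i k).trans htr) (abs_nonneg _)
  refine tendsto_pi_nhds.2 fun i => tendsto_pi_nhds.2 fun j => ?_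
  rw [tendsto_iff_norm_sub_tendsto_zero]
  refine squeeze_zero (fun _ => norm_nonneg _) (fun k => key (1 / ((k : ℝ) + 1)) (by positivity) i j)
    ?_
  simpa using (tendsto_one_div_add_atTop_nhds_zero_nat (𝕜 := ℝ)).mul_const
    (|Y i j| + ∑ k, (1 : Matrix q q ℝ).trace * |Y k j|)

theorem measurable_pinv {p q : Type*} [Fintype p] [Fintype q] :
    Measurable (pinv : Matrix p q ℝ → Matrix q p ℝ) := by
  classical
  refine measurable_of_tendsto_metrizable (f := fun (k : ℕ) (M : Matrix p q ℝ) =>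
    (Mᵀ * M + (1 / ((k : ℝ) + 1)) • (1 : Matrix q q ℝ))⁻¹ * Mᵀ) (fun k => ?_)
    (tendsto_pi_nhds.2 fun M => tendsto_regularized_pinv M)
  have ht : Measurable fun M : Matrix p q ℝ => Mᵀ := continuous_id.matrix_transpose.measurable
  have h1 : Measurable fun M : Matrix p q ℝ =>
      Mᵀ * M + (1 / ((k : ℝ) + 1)) • (1 : Matrix q q ℝ) :=
    ((continuous_id.matrix_transpose.matrix_mul continuous_id).add continuous_const).measurable
  exact measurable_matrix_mul.comp ((measurable_matrix_inv.comp h1).prodMk ht)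

theorem measurable_ricPi {n m : ℕ} :
    Measurable (ricPi : Matrix (Fin n ⊕ Fin m) (Fin n ⊕ Fin m) ℝ → _) := by
  have h11 : Measurable fun P : Matrix (Fin n ⊕ Fin m) (Fin n ⊕ Fin m) ℝ => P.toBlocks₁₁ :=
    (continuous_id.matrix_submatrix Sum.inl Sum.inl).measurable
  have h12 : Measurable fun P : Matrix (Fin n ⊕ Fin m) (Fin n ⊕ Fin m) ℝ => P.toBlocks₁₂ :=
    (continuous_id.matrix_submatrix Sum.inl Sum.inr).measurable
  have h21 : Measurable fun P : Matrix (Fin n ⊕ Fin m) (Fin n ⊕ Fin m) ℝ => P.toBlocks₂₁ :=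
    (continuous_id.matrix_submatrix Sum.inr Sum.inl).measurable
  have h22 : Measurable fun P : Matrix (Fin n ⊕ Fin m) (Fin n ⊕ Fin m) ℝ => P.toBlocks₂₂ :=
    (continuous_id.matrix_submatrix Sum.inr Sum.inr).measurable
  have hs : Measurable fun x : Matrix (Fin n) (Fin n) ℝ × Matrix (Fin n) (Fin n) ℝ =>
      x.1 - x.2 := (continuous_fst.sub continuous_snd).measurable
  exact hs.comp (h11.prodMk (measurable_matrix_mul.comp
    ((measurable_matrix_mul.comp (h12.prodMk (measurable_pinv.comp h22))).prodMk h21)))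

end Measurability

open scoped MatrixOrder

/-! ### Comparing the operator norm with the Loewner order. -/

section Loewner

variable {p : Type*} [Fintype p] [DecidableEq p]

theorem le_norm_smul_one {X : Matrix p p ℝ} (hX : X.IsHermitian) :
    X ≤ ‖X‖ • (1 : Matrix p p ℝ) := by
  rw [Matrix.le_iff]
  refine Matrix.PosSemidef.of_dotProduct_mulVec_nonneg ?_ fun x => ?_
  · exact (Matrix.isHermitian_one.smul (IsSelfAdjoint.all _)).sub hX
  · have h := X.l2_opNorm_mulVec (WithLp.toLp 2 x)
    have h2 := real_inner_le_norm (WithLp.toLp 2 (X *ᵥ x)) (WithLp.toLp 2 x)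
    have h3 : inner ℝ (WithLp.toLp 2 (X *ᵥ x)) (WithLp.toLp 2 x) = x ⬝ᵥ (X *ᵥ x) := by
      simp only [EuclideanSpace.inner_eq_star_dotProduct, star_trivial]
    have h4 : ‖WithLp.toLp 2 x‖ * ‖WithLp.toLp 2 x‖ = x ⬝ᵥ x := by
      rw [← real_inner_self_eq_norm_mul_norm]
      simp only [EuclideanSpace.inner_eq_star_dotProduct, star_trivial]
    have h5 : ‖WithLp.toLp 2 (X *ᵥ x)‖ ≤ ‖X‖ * ‖WithLp.toLp 2 x‖ := h
    rw [h3] at h2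
    have h6 := mul_le_mul_of_nonneg_right h5 (norm_nonneg (WithLp.toLp 2 x))
    rw [mul_assoc, h4] at h6
    simp only [star_trivial, Matrix.sub_mulVec, Matrix.smul_mulVec, Matrix.one_mulVec,
      dotProduct_sub, dotProduct_smul, smul_eq_mul]
    linarith

theorem neg_norm_smul_one_le {X : Matrix p p ℝ} (hX : X.IsHermitian) :
    -(‖X‖ • (1 : Matrix p p ℝ)) ≤ X := by
  have := le_norm_smul_one hX.neg
  rw [norm_neg] at this
  exact neg_le.1 this

theorem zero_le_one_matrix {q : Type*} [DecidableEq q] : (0 : Matrix q q ℝ) ≤ 1 :=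
  Matrix.nonneg_iff_posSemidef.2 Matrix.PosSemidef.one

/-- Factor `E = Bᴴ B`, bound `C = B⁻ᴴ B⁻¹` by a multiple of the identity and conjugate by `B`. The
summand `1` in the constant keeps it positive in dimension zero too. -/
theorem exists_smul_one_le {E : Matrix p p ℝ} (hE : E.PosDef) :
    ∃ δ : ℝ, 0 < δ ∧ δ • (1 : Matrix p p ℝ) ≤ E := by
  obtain ⟨B, hB⟩ := CStarAlgebra.nonneg_iff_eq_star_mul_self.1
    (Matrix.nonneg_iff_posSemidef.2 hE.posSemidef)
  rw [Matrix.star_eq_conjTranspose] at hB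
  have hu : IsUnit B.det := by
    have h1 := (Matrix.isUnit_iff_isUnit_det _).1 hE.isUnit
    rw [hB, Matrix.det_mul] at h1
    exact isUnit_of_mul_isUnit_right h1
  set C := (B⁻¹)ᴴ * B⁻¹ with hC
  have hCh : C.IsHermitian := Matrix.isHermitian_conjTranspose_mul_self _
  have hc : 0 < ‖C‖ + 1 := by positivity
  refine ⟨(‖C‖ + 1)⁻¹, inv_pos.2 hc, ?_⟩
  have h1 : C ≤ (‖C‖ + 1) • (1 : Matrix p p ℝ) := (le_norm_smul_one hCh).trans
    (smul_le_smul_of_nonneg_right (by linarith) zero_le_one_matrix)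
  have h2 := (Matrix.le_iff.1 h1).conjTranspose_mul_mul_same B
  have h3 : Bᴴ * C * B = 1 := by
    rw [hC, ← Matrix.mul_assoc, ← Matrix.conjTranspose_mul, Matrix.nonsing_inv_mul _ hu,
      Matrix.conjTranspose_one, Matrix.one_mul, Matrix.nonsing_inv_mul _ hu]
  rw [Matrix.mul_sub, Matrix.sub_mul, h3, Matrix.mul_smul, Matrix.mul_one, Matrix.smul_mul,
    ← hB] at h2
  have h4 := smul_le_smul_of_nonneg_left (Matrix.le_iff.2 h2) (inv_pos.2 hc).le
  rwa [smul_smul, inv_mul_cancel₀ hc.ne', one_smul] at h4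

theorem trace_mono {q : Type*} [Fintype q] {X Y : Matrix q q ℝ} (h : X ≤ Y) : X.trace ≤ Y.trace := by
  have := (Matrix.le_iff.1 h).trace_nonneg
  rw [Matrix.trace_sub] at this
  linarith

theorem isClosed_posSemidef {q : Type*} [Fintype q] : IsClosed {X : Matrix q q ℝ | X.PosSemidef} := by
  have : {X : Matrix q q ℝ | X.PosSemidef}
      = {X | Xᴴ = X} ∩ ⋂ x : q → ℝ, {X | 0 ≤ star x ⬝ᵥ (X *ᵥ x)} := by
    ext X
    simp [Matrix.posSemidef_iff_dotProduct_mulVec, Matrix.IsHermitian]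
  rw [this]
  refine (isClosed_eq continuous_id.matrix_conjTranspose continuous_id).inter
    (isClosed_iInter fun x => isClosed_le continuous_const ?_)
  exact continuous_const.dotProduct (continuous_id.matrix_mulVec continuous_const)

instance instOrderClosedTopologyMatrix : OrderClosedTopology (Matrix p p ℝ) where
  isClosed_le' := by
    have : {x : Matrix p p ℝ × Matrix p p ℝ | x.1 ≤ x.2}
        = (fun x => x.2 - x.1) ⁻¹' {X | X.PosSemidef} := rfl
    rw [this]
    exact isClosed_posSemidef.preimage (continuous_snd.sub continuous_fst)

/-- Any Hermitian matrix is dominated by a multiple of a matrix bounded below by `δ • 1`. -/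
theorem le_smul_of_smul_one_le {δ : ℝ} (hδ : 0 < δ) {X E : Matrix p p ℝ} (hX : X.IsHermitian)
    (h : δ • (1 : Matrix p p ℝ) ≤ E) : X ≤ (‖X‖ / δ) • E := by
  have : (‖X‖ / δ) • δ • (1 : Matrix p p ℝ) ≤ (‖X‖ / δ) • E :=
    smul_le_smul_of_nonneg_left h (div_nonneg (norm_nonneg X) hδ.le)
  rw [smul_smul, div_mul_cancel₀ _ hδ.ne'] at this
  exact (le_norm_smul_one hX).trans this

end Loewner

/-! ### Filtered noise and vanishing memory. -/

section Filter

variable {G : Type*} [NormedAddCommGroup G] [NormedSpace ℝ G]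

/-- The exponentially weighted average of the noise `m k • e k` with rates `a k`. -/
def noiseFilter (a m : ℕ → ℝ) (e : ℕ → G) : ℕ → G
  | 0 => 0
  | k + 1 => (1 - a k) • noiseFilter a m e k + m k • e k

theorem norm_noiseFilter_le {a m : ℕ → ℝ} {e : ℕ → G} (ha : ∀ k, a k ∈ Set.Icc (0 : ℝ) 1)
    (hm : Monotone m) (hm0 : ∀ k, 0 ≤ m k) {η : ℝ}
    (he : ∀ k, ‖∑ j ∈ Finset.range k, e j‖ ≤ η) (k : ℕ) :
    ‖noiseFilter a m e (k + 1)‖ ≤ 3 * η * m k := by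
  set r := noiseFilter a m e with hr
  set σ : ℕ → G := fun k => ∑ j ∈ Finset.range k, e j with hσ
  have hη : 0 ≤ η := (norm_nonneg _).trans (he 0)
  have hσS : ∀ k, σ (k + 1) = σ k + e k := fun k => Finset.sum_range_succ _ _
  have hrS : ∀ k, r (k + 1) = (1 - a k) • r k + m k • e k := fun k => rfl
  -- Summation by parts: up to the term `m k • σ (k + 1)`, the filter averages quantities of size `η
  -- * m k`. The increments of `m` telescope because `m` is monotone.
  have key : ∀ k, ‖r (k + 1) - m k • σ (k + 1)‖ ≤ 2 * η * m k := by
    intro k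
    induction k with
    | zero =>
      have : r (0 + 1) - m 0 • σ (0 + 1) = 0 := by
        rw [hrS, hσS]
        simp [hr, noiseFilter, hσ]
      rw [this, norm_zero]
      have := hm0 0
      positivity
    | succ k ih =>
      have hmm : 0 ≤ m (k + 1) - m k := sub_nonneg.2 (hm (Nat.le_succ k))
      have e1 : r (k + 1 + 1) - m (k + 1) • σ (k + 1 + 1)
          = (1 - a (k + 1)) • (r (k + 1) - m k • σ (k + 1))
            - (a (k + 1) * m k) • σ (k + 1) - (m (k + 1) - m k) • σ (k + 1) := by
        rw [hrS (k + 1), hσS (k + 1)]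
        module
      have h0 := (ha (k + 1)).1
      have h1 : 0 ≤ 1 - a (k + 1) := sub_nonneg.2 (ha (k + 1)).2
      have hmk := hm0 k
      have n1 : ‖(1 - a (k + 1)) • (r (k + 1) - m k • σ (k + 1))‖
          ≤ (1 - a (k + 1)) * (2 * η * m k) := by
        rw [norm_smul, Real.norm_of_nonneg h1]
        exact mul_le_mul_of_nonneg_left ih h1
      have n2 : ‖(a (k + 1) * m k) • σ (k + 1)‖ ≤ (a (k + 1) * m k) * η := by
        rw [norm_smul, Real.norm_of_nonneg (mul_nonneg h0 hmk)]
        exact mul_le_mul_of_nonneg_left (he _) (mul_nonneg h0 hmk)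
      have n3 : ‖(m (k + 1) - m k) • σ (k + 1)‖ ≤ (m (k + 1) - m k) * η := by
        rw [norm_smul, Real.norm_of_nonneg hmm]
        exact mul_le_mul_of_nonneg_left (he _) hmm
      rw [e1]
      refine (norm_sub_le _ _).trans ((add_le_add (norm_sub_le _ _) le_rfl).trans ?_)
      have p1 : 0 ≤ a (k + 1) * m k * η := by positivity
      have p2 : 0 ≤ (m (k + 1) - m k) * η := mul_nonneg hmm hη
      nlinarith
  have h1 := key k
  have h2 : ‖m k • σ (k + 1)‖ ≤ m k * η := by
    rw [norm_smul, Real.norm_of_nonneg (hm0 k)]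
    exact mul_le_mul_of_nonneg_left (he _) (hm0 k)
  have h3 : r (k + 1) = (r (k + 1) - m k • σ (k + 1)) + m k • σ (k + 1) := by abel
  rw [h3]
  refine (norm_add_le _ _).trans ?_
  linarith

theorem exists_forall_norm_tail_sum_le {H : Type*} [NormedAddCommGroup H] {e : ℕ → H} {l : H}
    (h : Tendsto (fun n => ∑ j ∈ Finset.range n, e j) atTop (𝓝 l)) {η : ℝ} (hη : 0 < η) :
    ∃ T₀, ∀ T ≥ T₀, ∀ k, ‖∑ j ∈ Finset.range k, e (T + j)‖ ≤ η := by
  obtain ⟨T₀, hT⟩ := Metric.cauchySeq_iff.1 h.cauchySeq η hη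
  refine ⟨T₀, fun T hT' k => ?_⟩
  have h1 := hT (T + k) (le_add_right hT') T hT'
  rw [dist_eq_norm, Finset.sum_range_add, add_sub_cancel_left] at h1
  exact h1.le

theorem tendsto_prod_one_sub {a : ℕ → ℝ} (ha : ∀ k, a k ∈ Set.Icc (0 : ℝ) 1)
    (hs : Tendsto (fun n => ∑ j ∈ Finset.range n, a j) atTop atTop) (T : ℕ) :
    Tendsto (fun k => ∏ j ∈ Finset.range k, (1 - a (T + j))) atTop (𝓝 0) := by
  have h1 : Tendsto (fun k => ∑ j ∈ Finset.range k, a (T + j)) atTop atTop := by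
    have h2 : Tendsto (fun k => ∑ j ∈ Finset.range (k + T), a j) atTop atTop :=
      hs.comp (tendsto_add_atTop_nat T)
    have h3 := tendsto_atTop_add_const_right atTop (-∑ j ∈ Finset.range T, a j) h2
    refine h3.congr fun k => ?_
    rw [add_comm k T, Finset.sum_range_add]
    ring
  refine squeeze_zero (fun k => Finset.prod_nonneg fun j _ => sub_nonneg.2 (ha _).2)
    (fun k => ?_) (Real.tendsto_exp_neg_atTop_nhds_zero.comp h1)
  calc ∏ j ∈ Finset.range k, (1 - a (T + j))
      ≤ ∏ j ∈ Finset.range k, Real.exp (-a (T + j)) :=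
        Finset.prod_le_prod (fun j _ => sub_nonneg.2 (ha _).2)
          fun j _ => Real.one_sub_le_exp_neg _
    _ = _ := by
        rw [← Real.exp_sum]
        simp

end Filter

/-! ### Trajectories that average a target up to noise. -/

section Averaging

variable {p : Type*} [Fintype p] [DecidableEq p]

theorem isHermitian_noiseFilter {a m : ℕ → ℝ} {e : ℕ → Matrix p p ℝ}
    (he : ∀ k, (e k).IsHermitian) (k : ℕ) : (noiseFilter a m e k).IsHermitian := by
  induction k with
  | zero => exact Matrix.isHermitian_zero
  | succ k ih => exact (ih.smul (IsSelfAdjoint.all _)).add ((he k).smul (IsSelfAdjoint.all _))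

theorem averaging_lower {a : ℕ → ℝ} (ha : ∀ k, a k ∈ Set.Icc (0 : ℝ) 1)
    {y g : ℕ → Matrix p p ℝ} (hy : ∀ k, y (k + 1) = (1 - a k) • y k + a k • g k)
    {B : Matrix p p ℝ} (hB : ∀ k, B ≤ g k) (k : ℕ) :
    B + (∏ j ∈ Finset.range k, (1 - a j)) • (y 0 - B) ≤ y k := by
  induction k with
  | zero => simp
  | succ k ih =>
    have h1 := smul_le_smul_of_nonneg_left ih (sub_nonneg.2 (ha k).2)
    have h2 := smul_le_smul_of_nonneg_left (hB k) (ha k).1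
    rw [hy, Finset.prod_range_succ]
    refine le_trans (le_of_eq ?_) (add_le_add h1 h2)
    module

end Averaging

/-- The trajectory `Q` averages `g` with rates `a`, perturbed by the noise `m t • e t`, where
`m` is monotone and the series `∑ e` converges. -/
structure IsNoisyAverage {p : Type*} [Fintype p] [DecidableEq p] (a m : ℕ → ℝ) (e g Q : ℕ → Matrix p p ℝ) : Prop where
  rate_mem : ∀ k, a k ∈ Set.Icc (0 : ℝ) 1
  rate_sum : Tendsto (fun n => ∑ j ∈ Finset.range n, a j) atTop atTop
  scale_mono : Monotone m
  scale_nonneg : ∀ k, 0 ≤ m k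
  noise_herm : ∀ k, (e k).IsHermitian
  noise_sum : ∃ l, Tendsto (fun n => ∑ j ∈ Finset.range n, e j) atTop (𝓝 l)
  herm : ∀ k, (Q k).IsHermitian
  step : ∀ k, Q (k + 1) = (1 - a k) • Q k + a k • g k + m k • e k

namespace IsNoisyAverage

variable {p : Type*} [Fintype p] [DecidableEq p] {a m : ℕ → ℝ} {e g Q : ℕ → Matrix p p ℝ}

theorem neg (h : IsNoisyAverage a m e g Q) :
    IsNoisyAverage a m (fun k => -e k) (fun k => -g k) (fun k => -Q k) where
  rate_mem := h.rate_mem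
  rate_sum := h.rate_sum
  scale_mono := h.scale_mono
  scale_nonneg := h.scale_nonneg
  noise_herm k := (h.noise_herm k).neg
  noise_sum := by
    obtain ⟨l, hl⟩ := h.noise_sum
    exact ⟨-l, by simpa using hl.neg⟩
  herm k := (h.herm k).neg
  step k := by
    rw [h.step k]
    module

/-- After removal of the filtered noise the trajectory is an exact average. -/
theorem exists_filtered (h : IsNoisyAverage a m e g Q) {η : ℝ} (hη : 0 < η) :
    ∃ T₀, ∀ T ≥ T₀, ∃ r y : ℕ → Matrix p p ℝ, (∀ k, Q (T + k) = y k + r k) ∧ y 0 = Q T ∧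
      (∀ k, y (k + 1) = (1 - a (T + k)) • y k + a (T + k) • g (T + k)) ∧
      (∀ k, (r k).IsHermitian) ∧ ∀ k, ‖r (k + 1)‖ ≤ 3 * η * m (T + k) := by
  obtain ⟨l, hl⟩ := h.noise_sum
  obtain ⟨T₀, hT₀⟩ := exists_forall_norm_tail_sum_le hl hη
  refine ⟨T₀, fun T hT => ?_⟩
  set r := noiseFilter (fun k => a (T + k)) (fun k => m (T + k)) (fun k => e (T + k)) with hr
  refine ⟨r, fun k => Q (T + k) - r k, fun k => by simp, ?_, fun k => ?_,
    isHermitian_noiseFilter fun k => h.noise_herm _, ?_⟩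
  · change Q T - 0 = Q T
    rw [sub_zero]
  · have h1 := h.step (T + k)
    have h2 : r (k + 1) = (1 - a (T + k)) • r k + m (T + k) • e (T + k) := rfl
    change Q (T + k + 1) - r (k + 1)
      = (1 - a (T + k)) • (Q (T + k) - r k) + a (T + k) • g (T + k)
    rw [h1, h2]
    module
  · exact norm_noiseFilter_le (fun k => h.rate_mem _)
      (fun i j hij => h.scale_mono (Nat.add_le_add_left hij T)) (fun k => h.scale_nonneg _)
      (hT₀ T hT)

/-- The filtered trajectory forgets its initial value because the rates have divergent sum, so it
ends above `B` minus half the slack. The bounded scale `m` makes the remaining noise consume at most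
the other half. -/
theorem eventually_lower (h : IsNoisyAverage a m e g Q) {M : ℝ} (hM : ∀ k, m k ≤ M)
    {B : Matrix p p ℝ} (hBh : B.IsHermitian) (hB : ∀ᶠ k in atTop, B ≤ g k) {η : ℝ} (hη : 0 < η) :
    ∀ᶠ k in atTop, B - η • (1 : Matrix p p ℝ) ≤ Q k := by
  have hM0 : 0 ≤ M := (h.scale_nonneg 0).trans (hM 0)
  -- Chosen so that the filter bound `3 * η' * m` is at most `η / 2`; `M + 1` avoids dividing by
  -- zero.
  have hη' : 0 < η / 2 / (3 * (M + 1)) := by positivity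
  obtain ⟨T₀, hT₀⟩ := h.exists_filtered hη'
  obtain ⟨T₁, hT₁⟩ := eventually_atTop.1 hB
  obtain ⟨r, y, hQ, -, hy, hrh, hr⟩ := hT₀ (max T₀ T₁) (le_max_left _ _)
  set T := max T₀ T₁ with hT
  have hlow := averaging_lower (a := fun k => a (T + k)) (fun k => h.rate_mem _) hy
    (B := B) fun k => hT₁ _ ((le_max_right _ _).trans (Nat.le_add_right _ _))
  have hlim : Tendsto (fun k => (∏ j ∈ Finset.range k, (1 - a (T + j))) * ‖y 0 - B‖) atTop
      (𝓝 0) := by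
    simpa using (tendsto_prod_one_sub h.rate_mem h.rate_sum T).mul_const ‖y 0 - B‖
  have hev : ∀ᶠ k in atTop, B - η • (1 : Matrix p p ℝ) ≤ Q (T + k) := by
    have hpos := hlim.eventually (gt_mem_nhds (half_pos hη))
    filter_upwards [hpos, eventually_ge_atTop 1] with k hk hk1
    obtain ⟨k, rfl⟩ : ∃ j, k = j + 1 := ⟨k - 1, by omega⟩
    have hy0 : (y 0 - B).IsHermitian := by
      have : y 0 = Q (T + 0) - r 0 := by rw [hQ]; abel
      rw [this]
      exact ((h.herm _).sub (hrh 0)).sub hBh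
    have hP0 : 0 ≤ ∏ j ∈ Finset.range (k + 1), (1 - a (T + j)) :=
      Finset.prod_nonneg fun j _ => sub_nonneg.2 (h.rate_mem _).2
    have h1 := smul_le_smul_of_nonneg_left (neg_norm_smul_one_le hy0) hP0
    rw [smul_neg, smul_smul] at h1
    have h2 : ((∏ j ∈ Finset.range (k + 1), (1 - a (T + j))) * ‖y 0 - B‖) • (1 : Matrix p p ℝ)
        ≤ (η / 2) • 1 := smul_le_smul_of_nonneg_right hk.le zero_le_one_matrix
    have h3 : ‖r (k + 1)‖ ≤ η / 2 := by
      refine (hr k).trans ?_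
      have := hM (T + k)
      calc 3 * (η / 2 / (3 * (M + 1))) * m (T + k) ≤ 3 * (η / 2 / (3 * (M + 1))) * (M + 1) := by
            gcongr
            linarith
        _ = η / 2 := by field_simp
    have h5 : ‖r (k + 1)‖ • (1 : Matrix p p ℝ) ≤ (η / 2) • 1 :=
      smul_le_smul_of_nonneg_right h3 zero_le_one_matrix
    have h4 : -((η / 2) • (1 : Matrix p p ℝ)) ≤ r (k + 1) :=
      (neg_le_neg h5).trans (neg_norm_smul_one_le (hrh (k + 1)))
    rw [hQ]
    calc B - η • (1 : Matrix p p ℝ)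
        = B + -((η / 2) • (1 : Matrix p p ℝ)) + -((η / 2) • (1 : Matrix p p ℝ)) := by module
      _ ≤ y (k + 1) + r (k + 1) := by
          refine add_le_add (le_trans (add_le_add le_rfl ?_) (hlow (k + 1))) h4
          exact (neg_le_neg h2).trans h1
  obtain ⟨k₀, hk₀⟩ := eventually_atTop.1 hev
  refine eventually_atTop.2 ⟨T + k₀, fun k hk => ?_⟩
  obtain ⟨j, rfl⟩ := Nat.exists_eq_add_of_le hk
  rw [add_assoc]
  exact hk₀ _ (Nat.le_add_right _ _)

theorem eventually_upper (h : IsNoisyAverage a m e g Q) {M : ℝ} (hM : ∀ k, m k ≤ M)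
    {B : Matrix p p ℝ} (hBh : B.IsHermitian) (hB : ∀ᶠ k in atTop, g k ≤ B) {η : ℝ} (hη : 0 < η) :
    ∀ᶠ k in atTop, Q k ≤ B + η • (1 : Matrix p p ℝ) := by
  filter_upwards [h.neg.eventually_lower hM hBh.neg (hB.mono fun k hk => neg_le_neg hk) hη]
    with k hk
  have := neg_le_neg hk
  rwa [neg_neg, neg_sub, sub_neg_eq_add, add_comm] at this

end IsNoisyAverage

/-! ### Deterministic dynamics of Riccati maps. -/

/-- The running maximum of a real sequence, started at `1`. -/
def runMax (u : ℕ → ℝ) : ℕ → ℝ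
  | 0 => max 1 (u 0)
  | k + 1 => max (runMax u k) (u (k + 1))

theorem monotone_runMax (u : ℕ → ℝ) : Monotone (runMax u) :=
  monotone_nat_of_le_succ fun _ => le_max_left _ _

theorem one_le_runMax (u : ℕ → ℝ) (k : ℕ) : 1 ≤ runMax u k :=
  (le_max_left 1 (u 0)).trans (monotone_runMax u (Nat.zero_le k))

theorem le_runMax (u : ℕ → ℝ) : ∀ k, u k ≤ runMax u k
  | 0 => le_max_right _ _
  | _ + 1 => le_max_right _ _

theorem runMax_le {u : ℕ → ℝ} {C : ℝ} (h : ∀ k, u k ≤ C) (k : ℕ) : runMax u k ≤ max 1 C := by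
  induction k with
  | zero => exact max_le_max le_rfl (h 0)
  | succ k ih => exact max_le ih ((h _).trans (le_max_right _ _))

/-- Monotone maps `F` with `F (c P) = E + c (F P - E)`, where `E` is positive definite: the mean
Riccati maps. -/
structure IsRiccatiMap {p : Type*} [Fintype p] (E : Matrix p p ℝ)
    (F : Matrix p p ℝ → Matrix p p ℝ) : Prop where
  posDef : E.PosDef
  mono : ∀ {P P' : Matrix p p ℝ}, 0 ≤ P → P ≤ P' → F P ≤ F P'
  smul : ∀ (c : ℝ) (P : Matrix p p ℝ), F (c • P) = E + c • (F P - E)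

namespace IsRiccatiMap

variable {p : Type*} [Fintype p] {E : Matrix p p ℝ} {F : Matrix p p ℝ → Matrix p p ℝ}

theorem map_zero (hF : IsRiccatiMap E F) : F 0 = E := by
  simpa using hF.smul 0 0

theorem le_map (hF : IsRiccatiMap E F) {P : Matrix p p ℝ} (hP : 0 ≤ P) : E ≤ F P := by
  have := hF.mono le_rfl hP
  rwa [hF.map_zero] at this

/-- The difference of the two sides is `(1 - s) • E`. This subhomogeneity replaces continuity of `F`
in what follows. -/
theorem smul_map_le_map_smul (hF : IsRiccatiMap E F) {s : ℝ} (hs : s ≤ 1) (P : Matrix p p ℝ) :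
    s • F P ≤ F (s • P) := by
  have h : 0 ≤ (1 - s) • E :=
    smul_nonneg (sub_nonneg.2 hs) (Matrix.nonneg_iff_posSemidef.2 hF.posDef.posSemidef)
  calc s • F P ≤ s • F P + (1 - s) • E := le_add_of_nonneg_right h
    _ = F (s • P) := by rw [hF.smul]; module

variable [DecidableEq p] {a : ℕ → ℝ} {e Q : ℕ → Matrix p p ℝ}

/-- A lower bound by the value iteration along a bounded trajectory. -/
theorem eventually_smul_iterate_le (hF : IsRiccatiMap E F) (hQ : ∀ k, 0 ≤ Q k)
    (h : IsNoisyAverage a (runMax fun k => (Q k).trace) e (fun k => F (Q k)) Q) {M : ℝ}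
    (hM : ∀ k, runMax (fun k => (Q k).trace) k ≤ M) (k : ℕ) :
    ∀ ε : ℝ, 0 < ε → ε ≤ 1 → ∀ᶠ t in atTop, (1 - ε) • F^[k] 0 ≤ Q t := by
  obtain ⟨δ, hδ, hδE⟩ := exists_smul_one_le hF.posDef
  have hV0 : ∀ k, 0 ≤ F^[k] (0 : Matrix p p ℝ) := fun k => by
    induction k with
    | zero => exact le_rfl
    | succ k ih =>
      rw [Function.iterate_succ_apply']
      exact (Matrix.nonneg_iff_posSemidef.2 hF.posDef.posSemidef).trans (hF.le_map ih)
  induction k with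
  | zero => exact fun ε _ _ => Eventually.of_forall fun t => by simpa using hQ t
  | succ k ih =>
    intro ε hε hε1
    rw [Function.iterate_succ_apply']
    set W := F (F^[k] 0) with hW
    have hEW : E ≤ W := hF.le_map (hV0 k)
    have hW0 : 0 ≤ W := (Matrix.nonneg_iff_posSemidef.2 hF.posDef.posSemidef).trans hEW
    -- Half of `ε` is spent on the induction hypothesis; the other half pays for the noise, since `W
    -- ≥ E ≥ δ • 1`.
    have hB : ∀ᶠ t in atTop, (1 - ε / 2) • W ≤ F (Q t) := by
      filter_upwards [ih (ε / 2) (half_pos hε) (by linarith)] with t ht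
      exact (hF.smul_map_le_map_smul (by linarith) _).trans
        (hF.mono (smul_nonneg (by linarith) (hV0 k)) ht)
    have hBh : ((1 - ε / 2) • W).IsHermitian :=
      (Matrix.nonneg_iff_posSemidef.1 hW0).1.smul (IsSelfAdjoint.all _)
    filter_upwards [h.eventually_lower hM hBh hB (η := ε / 2 * δ) (by positivity)] with t ht
    refine le_trans ?_ ht
    have h1 : (ε / 2) • δ • (1 : Matrix p p ℝ) ≤ (ε / 2) • W :=
      smul_le_smul_of_nonneg_left (hδE.trans hEW) (half_pos hε).le
    calc (1 - ε) • W = (1 - ε / 2) • W - (ε / 2) • W := by module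
      _ ≤ (1 - ε / 2) • W - (ε / 2) • δ • (1 : Matrix p p ℝ) := sub_le_sub_left h1 _
      _ = _ := by rw [smul_smul]

/-- A bounded trajectory forces the Riccati map to have a fixed point. -/
theorem exists_fixedPoint (hF : IsRiccatiMap E F) (hQ : ∀ k, 0 ≤ Q k)
    (h : IsNoisyAverage a (runMax fun k => (Q k).trace) e (fun k => F (Q k)) Q) {M : ℝ}
    (hM : ∀ k, runMax (fun k => (Q k).trace) k ≤ M) :
    ∃ P : Matrix p p ℝ, 0 ≤ P ∧ F P = P := by
  obtain ⟨δ, hδ, hδE⟩ := exists_smul_one_le hF.posDef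
  have hE0 : 0 ≤ E := Matrix.nonneg_iff_posSemidef.2 hF.posDef.posSemidef
  set V : ℕ → Matrix p p ℝ := fun k => F^[k] 0 with hV
  have hVS : ∀ k, V (k + 1) = F (V k) := fun k => Function.iterate_succ_apply' F k 0
  have hV0 : ∀ k, 0 ≤ V k := fun k => by
    induction k with
    | zero => exact le_rfl
    | succ k ih => rw [hVS]; exact hE0.trans (hF.le_map ih)
  have hVm : Monotone V := monotone_nat_of_le_succ fun k => by
    induction k with
    | zero => exact hV0 1
    | succ k ih =>
      rw [hVS k, hVS (k + 1)]
      exact hF.mono (hV0 k) ih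
  -- A single `ε = 1/2` bounds all value iterates, since the trajectory dominates half of each.
  have hVtr : ∀ k, (V k).trace ≤ 2 * M := fun k => by
    obtain ⟨t, ht⟩ := (hF.eventually_smul_iterate_le hQ h hM k (1 / 2) (by norm_num)
      (by norm_num)).exists
    have h1 := trace_mono ht
    rw [Matrix.trace_smul, smul_eq_mul] at h1
    have h2 := (le_runMax (fun k => (Q k).trace) t).trans (hM t)
    change _ * (V k).trace ≤ _ at h1
    linarith
  have hK : IsCompact (Set.univ.pi fun _ : p => Set.univ.pi fun _ : p =>
      Set.Icc (-(2 * M)) (2 * M)) :=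
    isCompact_univ_pi fun _ => isCompact_univ_pi fun _ => isCompact_Icc
  obtain ⟨L, φ, hφ, hL⟩ : ∃ (L : Matrix p p ℝ) (φ : ℕ → ℕ), StrictMono φ ∧
      Tendsto (fun j => V (φ j)) atTop (𝓝 L) := by
    obtain ⟨L, -, φ, hφ, hL⟩ := hK.tendsto_subseq (X := p → p → ℝ) (x := V) fun k i _ j _ =>
      abs_le.1 ((abs_apply_le_trace (Matrix.nonneg_iff_posSemidef.1 (hV0 k)) i j).trans (hVtr k))
    exact ⟨L, φ, hφ, hL⟩
  have hVL : ∀ k, V k ≤ L := fun k => by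
    refine ge_of_tendsto hL ?_
    filter_upwards [eventually_ge_atTop k] with j hj
    exact hVm (hj.trans (hφ.id_le j))
  have hL0 : 0 ≤ L := hVL 0
  have hEL : E ≤ L := by
    have := hVL 1
    rwa [hVS, show V 0 = 0 from rfl, hF.map_zero] at this
  have hLF : L ≤ F L := le_of_tendsto' hL fun j =>
    (hVm (Nat.le_succ (φ j))).trans (by rw [hVS]; exact hF.mono (hV0 _) (hVL _))
  refine ⟨L, hL0, le_antisymm ?_ hLF⟩
  -- Because `L ≥ δ • 1`, norm closeness becomes `(1 - ε) • L ≤ V (φ j)`; applying `F` avoids any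
  -- continuity of `F` at `L`.
  have key : ∀ ε : ℝ, 0 < ε → ε ≤ 1 → (1 - ε) • F L ≤ L := by
    intro ε hε hε1
    have h1 : Tendsto (fun j => ‖V (φ j) - L‖) atTop (𝓝 0) :=
      tendsto_iff_norm_sub_tendsto_zero.1 hL
    obtain ⟨j, hj⟩ := (h1.eventually (gt_mem_nhds (mul_pos hε hδ))).exists
    have hh : (V (φ j) - L).IsHermitian :=
      (Matrix.nonneg_iff_posSemidef.1 (hV0 _)).1.sub (Matrix.nonneg_iff_posSemidef.1 hL0).1
    have h2 : ‖V (φ j) - L‖ • (1 : Matrix p p ℝ) ≤ ε • L := by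
      calc ‖V (φ j) - L‖ • (1 : Matrix p p ℝ) ≤ (ε * δ) • 1 :=
            smul_le_smul_of_nonneg_right hj.le zero_le_one_matrix
        _ = ε • δ • (1 : Matrix p p ℝ) := (smul_smul _ _ _).symm
        _ ≤ ε • L := smul_le_smul_of_nonneg_left (hδE.trans hEL) hε.le
    have h3 : (1 - ε) • L ≤ V (φ j) := by
      have h4 := (neg_le_neg h2).trans (neg_norm_smul_one_le hh)
      calc (1 - ε) • L = -(ε • L) + L := by module
        _ ≤ (V (φ j) - L) + L := add_le_add h4 le_rfl
        _ = V (φ j) := sub_add_cancel _ _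
    calc (1 - ε) • F L ≤ F ((1 - ε) • L) := hF.smul_map_le_map_smul (by linarith) _
      _ ≤ F (V (φ j)) := hF.mono (smul_nonneg (by linarith) hL0) h3
      _ = V (φ j + 1) := (hVS _).symm
      _ ≤ L := hVL _
  have hlim : Tendsto (fun k : ℕ => (1 - 1 / ((k : ℝ) + 1)) • F L) atTop (𝓝 (F L)) := by
    simpa using ((tendsto_const_nhds (x := (1 : ℝ))).sub
      (tendsto_one_div_add_atTop_nhds_zero_nat (𝕜 := ℝ))).smul_const (F L)
  refine le_of_tendsto' hlim fun k => key _ (by positivity) ?_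
  rw [div_le_one (by positivity)]
  linarith [(Nat.cast_nonneg k : (0 : ℝ) ≤ k)]

theorem exists_smul_le (hF : IsRiccatiMap E F) {P : Matrix p p ℝ} (hP : P.IsHermitian) :
    ∃ c : ℝ, 0 < c ∧ c ≤ 1 ∧ c • P ≤ E := by
  obtain ⟨δ, hδ, hδE⟩ := exists_smul_one_le hF.posDef
  have hE0 : 0 ≤ E := Matrix.nonneg_iff_posSemidef.2 hF.posDef.posSemidef
  have h0 : 0 ≤ ‖P‖ / δ := by positivity
  refine ⟨(‖P‖ / δ + 1)⁻¹, by positivity, inv_le_one_of_one_le₀ (by linarith), ?_⟩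
  have h1 : P ≤ (‖P‖ / δ + 1) • E := (le_smul_of_smul_one_le hδ hP hδE).trans
    (smul_le_smul_of_nonneg_right (by linarith) hE0)
  have h2 : (‖P‖ / δ + 1)⁻¹ • P ≤ (‖P‖ / δ + 1)⁻¹ • (‖P‖ / δ + 1) • E :=
    smul_le_smul_of_nonneg_left h1 (by positivity)
  rwa [smul_smul, inv_mul_cancel₀ (by positivity), one_smul] at h2

/-- If the Riccati map has a fixed point then every trajectory is bounded. -/
theorem bounded_of_fixedPoint (hF : IsRiccatiMap E F) (hQ : ∀ k, 0 ≤ Q k)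
    (h : IsNoisyAverage a (runMax fun k => (Q k).trace) e (fun k => F (Q k)) Q)
    {P : Matrix p p ℝ} (hP0 : 0 ≤ P) (hP : F P = P) :
    (∃ M : ℝ, ∀ k, runMax (fun k => (Q k).trace) k ≤ M) ∧
      ∃ b : ℝ, 0 < b ∧ ∀ᶠ k in atTop, Q k ≤ b • P := by
  set m := runMax fun k => (Q k).trace with hm
  obtain ⟨δ, hδ, hδE⟩ := exists_smul_one_le hF.posDef
  have hEP : E ≤ P := by
    rw [← hP]
    exact hF.le_map hP0
  have hδP := hδE.trans hEP
  obtain ⟨c, hc0, hc1, hcE⟩ := hF.exists_smul_le (Matrix.nonneg_iff_posSemidef.1 hP0).1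
  have htrP : 0 ≤ P.trace := (Matrix.nonneg_iff_posSemidef.1 hP0).trace_nonneg
  set β := P.trace + 1 with hβ
  have hβ0 : 0 < β := by positivity
  -- This tolerance makes noise at scale `β * lam` cost at most `(c / 2 * lam) • P`. It does not
  -- involve `lam`, which is fixed only after the starting time `T`.
  have hη : 0 < c * δ / (6 * β) := by positivity
  obtain ⟨T, hT⟩ := h.exists_filtered hη
  obtain ⟨r, y, hQy, hy0, hy, hrh, hr⟩ := hT T le_rfl
  have hQT := le_smul_of_smul_one_le hδ (h.herm T) hδP
  have hl0 : 0 ≤ ‖Q T‖ / δ := by positivity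
  -- The three entries give `lam - 1 ≥ lam / 2`, the initial scale bound, and `Q T ≤ (lam / 2) • P ≤
  -- κ • P`, the last because `c ≤ 1`.
  set lam := max 2 (max (m T) (2 * (‖Q T‖ / δ))) with hlam
  have hlam2 : 2 ≤ lam := le_max_left _ _
  have hlamm : m T ≤ lam := (le_max_left _ _).trans (le_max_right _ _)
  have hlamQ : 2 * (‖Q T‖ / δ) ≤ lam := (le_max_right _ _).trans (le_max_right _ _)
  set κ := (1 - c / 2) * lam with hκ
  have hstep : ∀ X : Matrix p p ℝ, 0 ≤ X → X ≤ lam • P → F X ≤ κ • P := by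
    intro X hX0 hX
    have h1 := hF.mono hX0 hX
    rw [hF.smul, hP] at h1
    have h2 : (lam - 1) • c • P ≤ (lam - 1) • E :=
      smul_le_smul_of_nonneg_left hcE (by linarith)
    have h3 : (c / 2 * lam) • P ≤ ((lam - 1) * c) • P :=
      smul_le_smul_of_nonneg_right (by nlinarith) hP0
    rw [smul_smul] at h2
    calc F X ≤ E + lam • (P - E) := h1
      _ = lam • P - (lam - 1) • E := by module
      _ ≤ lam • P - (c / 2 * lam) • P := sub_le_sub_left (h3.trans h2) _
      _ = κ • P := by rw [hκ]; module
  have hQ0 : Q T ≤ κ • P := hQT.trans (smul_le_smul_of_nonneg_right (by nlinarith) hP0)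
  -- The three bounds propagate together: `F` sends the region below `lam • P` under `κ • P`, the
  -- filtered noise fits in the gap `lam - κ`, and `β` exceeds the trace of `P`, so the running
  -- maximum stays below `β * lam`.
  have key : ∀ k, Q (T + k) ≤ lam • P ∧ m (T + k) ≤ β * lam ∧ y k ≤ κ • P := by
    intro k
    induction k with
    | zero =>
      refine ⟨hQ0.trans (smul_le_smul_of_nonneg_right (by nlinarith) hP0), ?_, by rwa [hy0]⟩
      have : m (T + 0) ≤ lam := hlamm
      nlinarith
    | succ k ih =>
      obtain ⟨i1, i2, i3⟩ := ih
      have hak := h.rate_mem (T + k)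
      have y1 : y (k + 1) ≤ κ • P := by
        rw [hy]
        have s1 : (1 - a (T + k)) • y k ≤ (1 - a (T + k)) • κ • P :=
          smul_le_smul_of_nonneg_left i3 (sub_nonneg.2 hak.2)
        have s2 : a (T + k) • F (Q (T + k)) ≤ a (T + k) • κ • P :=
          smul_le_smul_of_nonneg_left (hstep _ (hQ _) i1) hak.1
        refine (add_le_add s1 s2).trans (le_of_eq ?_)
        module
      have r1 : r (k + 1) ≤ (c / 2 * lam) • P := by
        refine (le_smul_of_smul_one_le hδ (hrh (k + 1)) hδP).trans
          (smul_le_smul_of_nonneg_right ?_ hP0)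
        rw [div_le_iff₀ hδ]
        calc ‖r (k + 1)‖ ≤ 3 * (c * δ / (6 * β)) * m (T + k) := hr k
          _ ≤ 3 * (c * δ / (6 * β)) * (β * lam) := by gcongr
          _ = c / 2 * lam * δ := by field_simp; ring
      have q1 : Q (T + (k + 1)) ≤ lam • P := by
        rw [hQy]
        refine (add_le_add y1 r1).trans (le_of_eq ?_)
        rw [hκ]
        module
      refine ⟨q1, max_le i2 ?_, y1⟩
      have := trace_mono q1
      rw [Matrix.trace_smul, smul_eq_mul] at this
      change (Q (T + (k + 1))).trace ≤ β * lam
      rw [hβ]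
      nlinarith
  refine ⟨⟨β * lam, fun k => (h.scale_mono (Nat.le_add_left k T)).trans (key k).2.1⟩,
    lam, by linarith, eventually_atTop.2 ⟨T, fun k hk => ?_⟩⟩
  obtain ⟨j, rfl⟩ := Nat.exists_eq_add_of_le hk
  exact (key j).1

/-- If the Riccati map has a fixed point then every trajectory converges to it. -/
theorem tendsto_of_fixedPoint (hF : IsRiccatiMap E F) (hQ : ∀ k, 0 ≤ Q k)
    (h : IsNoisyAverage a (runMax fun k => (Q k).trace) e (fun k => F (Q k)) Q)
    {P : Matrix p p ℝ} (hP0 : 0 ≤ P) (hP : F P = P) :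
    Tendsto Q atTop (𝓝 P) := by
  obtain ⟨⟨M, hM⟩, b, hb, hQb⟩ := hF.bounded_of_fixedPoint hQ h hP0 hP
  obtain ⟨δ, hδ, hδE⟩ := exists_smul_one_le hF.posDef
  have hEP : E ≤ P := by
    rw [← hP]
    exact hF.le_map hP0
  have hδP := hδE.trans hEP
  have hPh := (Matrix.nonneg_iff_posSemidef.1 hP0).1
  obtain ⟨c, hc0, hc1, hcE⟩ := hF.exists_smul_le hPh
  -- Since `c • P ≤ E`, the map `F` shrinks a relative error `s` to at most `s * (1 - c)`; conceding
  -- `s * c / 2` to the noise leaves the factor `θ`.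
  set θ := 1 - c / 2 with hθ
  have hθ0 : 0 < θ := by linarith
  have hθ1 : θ < 1 := by linarith
  have hs0 : ∀ j : ℕ, 0 < θ ^ j := fun j => pow_pos hθ0 j
  have hs1 : ∀ j : ℕ, θ ^ j ≤ 1 := fun j => pow_le_one₀ hθ0.le hθ1.le
  have hone : ∀ s : ℝ, 0 ≤ s → (s * δ) • (1 : Matrix p p ℝ) ≤ s • P := fun s hs => by
    rw [← smul_smul]
    exact smul_le_smul_of_nonneg_left hδP hs
  have hlow : ∀ j : ℕ, ∀ᶠ k in atTop, (1 - θ ^ j) • P ≤ Q k := by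
    intro j
    induction j with
    | zero => exact Eventually.of_forall fun k => by simpa using hQ k
    | succ j ih =>
      have hs := hs0 j
      have hs' := hs1 j
      rw [pow_succ]
      set s := θ ^ j
      have hB : ∀ᶠ k in atTop, (1 - s + s * c) • P ≤ F (Q k) := by
        filter_upwards [ih] with k hk
        have h1 := hF.mono (smul_nonneg (sub_nonneg.2 hs') hP0) hk
        rw [hF.smul, hP] at h1
        refine le_trans ?_ h1
        have h2 : s • c • P ≤ s • E := smul_le_smul_of_nonneg_left hcE hs.le
        calc (1 - s + s * c) • P = (1 - s) • P + s • c • P := by module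
          _ ≤ (1 - s) • P + s • E := add_le_add le_rfl h2
          _ = _ := by module
      have hη : 0 < s * c / 2 * δ := by positivity
      filter_upwards [h.eventually_lower hM (hPh.smul (IsSelfAdjoint.all _)) hB hη] with k hk
      refine le_trans ?_ hk
      have h3 := hone (s * c / 2) (by positivity)
      calc (1 - s * θ) • P = (1 - s + s * c) • P - (s * c / 2) • P := by rw [hθ]; module
        _ ≤ _ := sub_le_sub_left h3 _
  have hup : ∀ j : ℕ, ∀ᶠ k in atTop, Q k ≤ (1 + b * θ ^ j) • P := by
    intro j
    induction j with
    | zero =>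
      filter_upwards [hQb] with k hk
      exact hk.trans (smul_le_smul_of_nonneg_right (by simp) hP0)
    | succ j ih =>
      have hs : 0 < b * θ ^ j := mul_pos hb (hs0 j)
      rw [pow_succ, ← mul_assoc]
      set s := b * θ ^ j
      have hB : ∀ᶠ k in atTop, F (Q k) ≤ (1 + s - s * c) • P := by
        filter_upwards [ih] with k hk
        have h1 := hF.mono (hQ k) hk
        rw [hF.smul, hP] at h1
        refine le_trans h1 ?_
        have h2 : s • c • P ≤ s • E := smul_le_smul_of_nonneg_left hcE hs.le
        calc E + (1 + s) • (P - E) = (1 + s) • P - s • E := by module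
          _ ≤ (1 + s) • P - s • c • P := sub_le_sub_left h2 _
          _ = _ := by module
      have hη : 0 < s * c / 2 * δ := by positivity
      filter_upwards [h.eventually_upper hM (hPh.smul (IsSelfAdjoint.all _)) hB hη] with k hk
      refine hk.trans ?_
      have h3 := hone (s * c / 2) (by positivity)
      calc _ ≤ (1 + s - s * c) • P + (s * c / 2) • P := add_le_add le_rfl h3
        _ = (1 + s * θ) • P := by rw [hθ]; module
  refine tendsto_pi_nhds.2 fun i => tendsto_pi_nhds.2 fun j => Metric.tendsto_atTop.2 fun ε hε => ?_
  have hlim : Tendsto (fun J : ℕ => θ ^ J * ((2 + b) * P.trace)) atTop (𝓝 0) := by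
    simpa using (tendsto_pow_atTop_nhds_zero_of_lt_one hθ0.le hθ1).mul_const ((2 + b) * P.trace)
  obtain ⟨J, hJ⟩ := (hlim.eventually (gt_mem_nhds hε)).exists
  obtain ⟨K, hK⟩ := eventually_atTop.1 ((hlow J).and (hup J))
  refine ⟨K, fun k hk => ?_⟩
  obtain ⟨h1, h2⟩ := hK k hk
  set s := θ ^ J
  have hX := Matrix.le_iff.1 h1
  have hXt : (Q k - (1 - s) • P).trace ≤ (1 + b) * s * P.trace := by
    have h3 : Q k - (1 - s) • P ≤ ((1 + b) * s) • P := by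
      refine (sub_le_sub_right h2 _).trans (le_of_eq ?_)
      module
    have := trace_mono h3
    rwa [Matrix.trace_smul, smul_eq_mul] at this
  have h4 := (abs_apply_le_trace hX i j).trans hXt
  have h5 := abs_apply_le_trace (Matrix.nonneg_iff_posSemidef.1 hP0) i j
  have e1 : Q k i j - P i j = (Q k - (1 - s) • P) i j - s * P i j := by
    simp only [Matrix.sub_apply, Matrix.smul_apply, smul_eq_mul]
    ring
  rw [Real.dist_eq, e1]
  have h6 : |s * P i j| ≤ s * P.trace := by
    rw [abs_mul, abs_of_pos (hs0 J)]
    exact mul_le_mul_of_nonneg_left h5 (hs0 J).le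
  calc _ ≤ |(Q k - (1 - s) • P) i j| + |s * P i j| := abs_sub _ _
    _ ≤ (1 + b) * s * P.trace + s * P.trace := add_le_add h4 h6
    _ = s * ((2 + b) * P.trace) := by ring
    _ < ε := hJ

end IsRiccatiMap

/-! ### The random model: moments, independence and noise. -/

theorem posSemidef_matExp {Ω : Type*} [MeasurableSpace Ω] {μ : Measure Ω} {p : Type*} [Fintype p]
    {M : Ω → Matrix p p ℝ} (hint : ∀ i j, Integrable (fun ω => M ω i j) μ)
    (hM : ∀ᵐ ω ∂μ, (M ω).PosSemidef) : (matExp μ M).PosSemidef := by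
  refine Matrix.PosSemidef.of_dotProduct_mulVec_nonneg ?_ fun x => ?_
  · refine Matrix.IsHermitian.ext fun i j => ?_
    rw [star_trivial]
    refine integral_congr_ae ?_
    filter_upwards [hM] with ω hω
    simpa using hω.1.apply i j
  · have e : star x ⬝ᵥ (matExp μ M *ᵥ x) = ∫ ω, star x ⬝ᵥ (M ω *ᵥ x) ∂μ := by
      simp only [dotProduct, Matrix.mulVec, matExp, Matrix.of_apply]
      rw [integral_finsetSum]
      · refine Finset.sum_congr rfl fun i _ => ?_
        rw [integral_const_mul, integral_finsetSum]
        · simp_rw [integral_mul_const]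
        · exact fun j _ => (hint i j).mul_const _
      · exact fun i _ => (integrable_finsetSum _ fun j _ => (hint i j).mul_const _).const_mul _
    rw [e]
    refine integral_nonneg_of_ae ?_
    filter_upwards [hM] with ω hω
    exact hω.dotProduct_mulVec_nonneg x

theorem trace_le_card_mul_norm {p : Type*} [Fintype p] [DecidableEq p] {X : Matrix p p ℝ}
    (hX : X.IsHermitian) : X.trace ≤ Fintype.card p * ‖X‖ := by
  have h := trace_mono (le_norm_smul_one hX)
  rw [Matrix.trace_smul, Matrix.trace_one, smul_eq_mul, mul_comm] at h
  exact h

theorem transpose_mul_mul_apply {p q : Type*} [Fintype p] (B : Matrix p q ℝ)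
    (M : Matrix p p ℝ) (i j : q) : (Bᵀ * M * B) i j = ∑ l, ∑ k, M k l * (B k i * B l j) := by
  simp only [Matrix.mul_apply, Matrix.transpose_apply, Finset.sum_mul]
  refine Finset.sum_congr rfl fun l _ => Finset.sum_congr rfl fun k _ => ?_
  ring

theorem comap_le_pastSigma {Ω : Type*} {n m : ℕ} {A : ℕ → Ω → Matrix (Fin n) (Fin n ⊕ Fin m) ℝ}
    {N : ℕ → Ω → Matrix (Fin n ⊕ Fin m) (Fin n ⊕ Fin m) ℝ} {s t : ℕ}
    (hs : 1 ≤ s) (hst : s ≤ t) :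
    MeasurableSpace.comap (A s) inferInstance ⊔ MeasurableSpace.comap (N s) inferInstance
      ≤ pastSigma A N t :=
  le_iSup₂_of_le (f := fun i (_ : i ∈ Finset.Icc 1 t) =>
    (MeasurableSpace.comap (A i) inferInstance ⊔ MeasurableSpace.comap (N i) inferInstance)) s
    (Finset.mem_Icc.2 ⟨hs, hst⟩) le_rfl

theorem measurable_pair_past {Ω : Type*} {n m : ℕ} {A : ℕ → Ω → Matrix (Fin n) (Fin n ⊕ Fin m) ℝ}
    {N : ℕ → Ω → Matrix (Fin n ⊕ Fin m) (Fin n ⊕ Fin m) ℝ} {s t : ℕ}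
    (hs : 1 ≤ s) (hst : s ≤ t) :
    Measurable[pastSigma A N t] fun ω => (A s ω, N s ω) := by
  have h1 : Measurable[pastSigma A N t] (A s) :=
    measurable_iff_comap_le.2 (le_sup_left.trans (comap_le_pastSigma hs hst))
  have h2 : Measurable[pastSigma A N t] (N s) :=
    measurable_iff_comap_le.2 (le_sup_right.trans (comap_le_pastSigma hs hst))
  exact h1.prodMk h2

/-- The standing assumptions on the parameters and the learning rates. -/
structure IsModel {Ω : Type*} [MeasurableSpace Ω] (μ : Measure Ω) {n m : ℕ}
    (A : ℕ → Ω → Matrix (Fin n) (Fin n ⊕ Fin m) ℝ)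
    (N : ℕ → Ω → Matrix (Fin n ⊕ Fin m) (Fin n ⊕ Fin m) ℝ)
    (α : ℕ → Ω → ℝ) : Prop where
  meas_A : ∀ t, 1 ≤ t → Measurable (A t)
  meas_N : ∀ t, 1 ≤ t → Measurable (N t)
  indep : iIndepFun (fun (t : ℕ) (ω : Ω) => (A (t + 1) ω, N (t + 1) ω)) μ
  ident : ∀ t, 1 ≤ t →
      IdentDistrib (fun ω => (A t ω, N t ω)) (fun ω => (A 1 ω, N 1 ω)) μ μ
  psd_N : ∀ t, 1 ≤ t → ∀ᵐ ω ∂μ, (N t ω).PosSemidef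
  moment : Integrable (fun ω => ‖N 1 ω‖ ^ 2 + ‖(A 1 ω)ᵀ * A 1 ω‖ ^ 2) μ
  posDef_mean : (matExp μ (N 1)).PosDef
  meas_rate : ∀ t, Measurable[pastSigma A N t] (α t)
  rate_mem : ∀ᵐ ω ∂μ, ∀ t, α t ω ∈ Set.Icc (0 : ℝ) 1
  rate_sum : ∀ᵐ ω ∂μ, Tendsto (fun T => ∑ t ∈ Finset.range T, α t ω) atTop atTop
  rate_sq : ∀ᵐ ω ∂μ, Summable (fun t => α t ω ^ 2)

/-- The mean Riccati map `F(P) = E[N] + E[Aᵀ Π(P) A]`. -/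
def meanRiccati {Ω : Type*} [MeasurableSpace Ω] (μ : Measure Ω) {n m : ℕ}
    (A : Ω → Matrix (Fin n) (Fin n ⊕ Fin m) ℝ)
    (N : Ω → Matrix (Fin n ⊕ Fin m) (Fin n ⊕ Fin m) ℝ)
    (P : Matrix (Fin n ⊕ Fin m) (Fin n ⊕ Fin m) ℝ) :
    Matrix (Fin n ⊕ Fin m) (Fin n ⊕ Fin m) ℝ :=
  matExp μ N + matExp μ fun ω => (A ω)ᵀ * ricPi P * A ω

namespace IsModel

variable {Ω : Type*} [MeasurableSpace Ω] {μ : Measure Ω} {n m : ℕ}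
  {A : ℕ → Ω → Matrix (Fin n) (Fin n ⊕ Fin m) ℝ}
  {N : ℕ → Ω → Matrix (Fin n ⊕ Fin m) (Fin n ⊕ Fin m) ℝ} {α : ℕ → Ω → ℝ}

theorem memLp_N (h : IsModel μ A N α) (i j : Fin n ⊕ Fin m) :
    MemLp (fun ω => N 1 ω i j) 2 μ := by
  have hm : Measurable fun ω => N 1 ω i j :=
    (measurable_pi_apply j).comp ((measurable_pi_apply i).comp (h.meas_N 1 le_rfl))
  refine (memLp_two_iff_integrable_sq hm.aestronglyMeasurable).2
    ((h.moment.const_mul ((Fintype.card (Fin n ⊕ Fin m) : ℝ) ^ 2)).mono'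
      (hm.pow_const 2).aestronglyMeasurable ?_)
  filter_upwards [h.psd_N 1 le_rfl] with ω hω
  have h1 := (abs_apply_le_trace hω i j).trans (trace_le_card_mul_norm hω.1)
  have h2 := pow_le_pow_left₀ (abs_nonneg _) h1 2
  rw [sq_abs, mul_pow (Fintype.card (Fin n ⊕ Fin m) : ℝ)] at h2
  rw [Real.norm_of_nonneg (sq_nonneg _)]
  refine h2.trans (mul_le_mul_of_nonneg_left ?_ (sq_nonneg _))
  exact le_add_of_nonneg_right (sq_nonneg _)

/-- A product of two entries is at most the trace of `Aᵀ A`, whose square is controlled by the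
moment assumption. -/
theorem memLp_A (h : IsModel μ A N α) (k l : Fin n) (i j : Fin n ⊕ Fin m) :
    MemLp (fun ω => A 1 ω k i * A 1 ω l j) 2 μ := by
  have hA : ∀ k i, Measurable fun ω => A 1 ω k i := fun k i =>
    (measurable_pi_apply i).comp ((measurable_pi_apply k).comp (h.meas_A 1 le_rfl))
  have hm : Measurable fun ω => A 1 ω k i * A 1 ω l j := (hA k i).mul (hA l j)
  refine (memLp_two_iff_integrable_sq hm.aestronglyMeasurable).2
    ((h.moment.const_mul ((Fintype.card (Fin n ⊕ Fin m) : ℝ) ^ 2)).mono'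
      (hm.pow_const 2).aestronglyMeasurable (ae_of_all _ fun ω => ?_))
  have hp := posSemidef_transpose_mul_self (A 1 ω)
  have hd : ∀ k i, A 1 ω k i ^ 2 ≤ ((A 1 ω)ᵀ * A 1 ω).trace := fun k i => by
    refine le_trans ?_ (apply_le_trace hp i)
    rw [Matrix.mul_apply]
    simp only [Matrix.transpose_apply, ← sq]
    exact Finset.single_le_sum (f := fun k => A 1 ω k i ^ 2) (fun _ _ => sq_nonneg _)
      (Finset.mem_univ k)
  have h1 : |A 1 ω k i * A 1 ω l j| ≤ ((A 1 ω)ᵀ * A 1 ω).trace := by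
    have a1 := hd k i
    have a2 := hd l j
    rw [abs_le]
    constructor <;> nlinarith [sq_nonneg (A 1 ω k i - A 1 ω l j), sq_nonneg (A 1 ω k i + A 1 ω l j)]
  have h2 := pow_le_pow_left₀ (abs_nonneg _) (h1.trans (trace_le_card_mul_norm hp.1)) 2
  rw [sq_abs, mul_pow (Fintype.card (Fin n ⊕ Fin m) : ℝ)] at h2
  rw [Real.norm_of_nonneg (sq_nonneg _)]
  refine h2.trans (mul_le_mul_of_nonneg_left ?_ (sq_nonneg _))
  exact le_add_of_nonneg_left (sq_nonneg _)

theorem integrable_conj [IsProbabilityMeasure μ] (h : IsModel μ A N α)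
    (M : Matrix (Fin n) (Fin n) ℝ) (i j : Fin n ⊕ Fin m) :
    Integrable (fun ω => ((A 1 ω)ᵀ * M * A 1 ω) i j) μ := by
  simp only [transpose_mul_mul_apply]
  exact integrable_finsetSum _ fun l _ => integrable_finsetSum _ fun k _ =>
    ((h.memLp_A k l i j).integrable one_le_two).const_mul _

/-- Linearity in `M` becomes explicit: only the second moments of the entries of `A` enter the mean
map. -/
theorem matExp_conj_apply [IsProbabilityMeasure μ] (h : IsModel μ A N α)
    (M : Matrix (Fin n) (Fin n) ℝ) (i j : Fin n ⊕ Fin m) :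
    matExp μ (fun ω => (A 1 ω)ᵀ * M * A 1 ω) i j
      = ∑ l, ∑ k, M k l * ∫ ω, A 1 ω k i * A 1 ω l j ∂μ := by
  have hi : ∀ k l, Integrable (fun ω => M k l * (A 1 ω k i * A 1 ω l j)) μ := fun k l =>
    ((h.memLp_A k l i j).integrable one_le_two).const_mul _
  simp only [matExp, Matrix.of_apply, transpose_mul_mul_apply]
  rw [integral_finsetSum _ fun l _ => integrable_finsetSum _ fun k _ => hi k l]
  refine Finset.sum_congr rfl fun l _ => ?_
  rw [integral_finsetSum _ fun k _ => hi k l]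
  exact Finset.sum_congr rfl fun k _ => integral_const_mul _ _

theorem isRiccatiMap [IsProbabilityMeasure μ] (h : IsModel μ A N α) :
    IsRiccatiMap (matExp μ (N 1)) (meanRiccati μ (A 1) (N 1)) where
  posDef := h.posDef_mean
  mono {P P'} hP hPP' := by
    refine add_le_add le_rfl ?_
    have h1 := Matrix.le_iff.1 (ricPi_mono (Matrix.nonneg_iff_posSemidef.1 hP) hPP')
    rw [Matrix.le_iff]
    have h2 : (matExp μ fun ω => (A 1 ω)ᵀ * ricPi P' * A 1 ω)
        - (matExp μ fun ω => (A 1 ω)ᵀ * ricPi P * A 1 ω)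
        = matExp μ fun ω => (A 1 ω)ᵀ * (ricPi P' - ricPi P) * A 1 ω := by
      ext i j
      rw [Matrix.sub_apply, h.matExp_conj_apply, h.matExp_conj_apply, h.matExp_conj_apply]
      simp only [← Finset.sum_sub_distrib, ← sub_mul, Matrix.sub_apply]
    rw [h2]
    refine posSemidef_matExp (h.integrable_conj _) (ae_of_all _ fun ω => ?_)
    have := h1.conjTranspose_mul_mul_same (A 1 ω)
    rwa [Matrix.conjTranspose_eq_transpose_of_trivial] at this
  smul c P := by
    have h2 : (matExp μ fun ω => (A 1 ω)ᵀ * ricPi (c • P) * A 1 ω)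
        = c • matExp μ fun ω => (A 1 ω)ᵀ * ricPi P * A 1 ω := by
      ext i j
      rw [Matrix.smul_apply, h.matExp_conj_apply, h.matExp_conj_apply, ricPi_smul]
      simp only [Matrix.smul_apply, smul_eq_mul, Finset.mul_sum, mul_assoc]
    rw [meanRiccati, meanRiccati, h2]
    module

/-- The filtration of the observations. -/
def filtration (h : IsModel μ A N α) : Filtration ℕ ‹MeasurableSpace Ω› where
  seq := pastSigma A N
  mono' _ _ hst := iSup₂_le fun i hi => le_iSup₂_of_le (f := fun i (_ : i ∈ Finset.Icc 1 _) =>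
      (MeasurableSpace.comap (A i) inferInstance ⊔ MeasurableSpace.comap (N i) inferInstance)) i
    (Finset.Icc_subset_Icc_right hst hi) le_rfl
  le' _ := iSup₂_le fun i hi => sup_le (h.meas_A i (Finset.mem_Icc.1 hi).1).comap_le
    (h.meas_N i (Finset.mem_Icc.1 hi).1).comap_le

theorem indep_past (h : IsModel μ A N α) (t : ℕ) :
    Indep (MeasurableSpace.comap (fun ω => (A (t + 1) ω, N (t + 1) ω)) inferInstance)
      (pastSigma A N t) μ := by
  have hξ : ∀ s, Measurable fun ω => (A (s + 1) ω, N (s + 1) ω) := fun s =>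
    (h.meas_A _ (Nat.le_add_left 1 s)).prodMk (h.meas_N _ (Nat.le_add_left 1 s))
  have h1 := indep_iSup_of_disjoint (fun s => (hξ s).comap_le)
    ((iIndepFun_iff_iIndep _ _ _).1 h.indep) (S := {t}) (T := {s | s < t})
    (Set.disjoint_singleton_left.2 (lt_irrefl t))
  refine indep_of_indep_of_le_right (indep_of_indep_of_le_left h1 ?_) ?_
  · exact le_iSup₂_of_le (f := fun i (_ : i ∈ ({t} : Set ℕ)) =>
      MeasurableSpace.comap (fun ω => (A (i + 1) ω, N (i + 1) ω)) inferInstance) t rfl le_rfl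
  · refine iSup₂_le fun s hs => ?_
    obtain ⟨hs1, hst⟩ := Finset.mem_Icc.1 hs
    obtain ⟨s, rfl⟩ : ∃ r, s = r + 1 := ⟨s - 1, by omega⟩
    refine le_trans ?_ (le_iSup₂_of_le (f := fun i (_ : i ∈ {s | s < t}) =>
      MeasurableSpace.comap (fun ω => (A (i + 1) ω, N (i + 1) ω)) inferInstance) s hst le_rfl)
    have hc := comap_measurable (m := inferInstance) fun ω => (A (s + 1) ω, N (s + 1) ω)
    exact sup_le (measurable_fst.comp hc).comap_le (measurable_snd.comp hc).comap_le

/-- Noise series with predictable weights dominated by the learning rates converge. -/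
theorem ae_tendsto_sum_noise [IsProbabilityMeasure μ] (h : IsModel μ A N α)
    {φ : Matrix (Fin n) (Fin n ⊕ Fin m) ℝ × Matrix (Fin n ⊕ Fin m) (Fin n ⊕ Fin m) ℝ → ℝ}
    (hφ : Measurable φ) (hL2 : MemLp (fun ω => φ (A 1 ω, N 1 ω)) 2 μ) {W : ℕ → Ω → ℝ}
    (hW : ∀ t, Measurable[pastSigma A N t] (W t))
    (hWα : ∀ᵐ ω ∂μ, ∀ t, |W t ω| ≤ α t ω) :
    ∀ᵐ ω ∂μ, ∃ l : ℝ, Tendsto (fun T => ∑ t ∈ Finset.range T,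
      W t ω * (φ (A (t + 1) ω, N (t + 1) ω) - ∫ ω, φ (A 1 ω, N 1 ω) ∂μ)) atTop (𝓝 l) := by
  set c := ∫ ω, φ (A 1 ω, N 1 ω) ∂μ with hc
  have hψ : Measurable fun x => φ x - c := hφ.sub_const c
  have hid : ∀ t, IdentDistrib (fun ω => φ (A (t + 1) ω, N (t + 1) ω) - c)
      (fun ω => φ (A 1 ω, N 1 ω) - c) μ μ := fun t =>
    (h.ident (t + 1) (Nat.le_add_left 1 t)).comp hψ
  have hL2' : MemLp (fun ω => φ (A 1 ω, N 1 ω) - c) 2 μ := hL2.sub (memLp_const c)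
  refine ae_tendsto_sum_mul_of_summable_sq h.filtration hW
    (Y := fun t ω => φ (A (t + 1) ω, N (t + 1) ω) - c)
    (fun t => hψ.comp (measurable_pair_past (Nat.le_add_left 1 t) le_rfl)) (fun t => ?_)
    (fun t => (hid t).memLp_iff.2 hL2') (fun t => ?_)
    (v := ∫ ω, (φ (A 1 ω, N 1 ω) - c) ^ 2 ∂μ) (fun t => ?_) ?_
  · refine indep_of_indep_of_le_left (h.indep_past t) ?_
    exact (hψ.comp (comap_measurable fun ω => (A (t + 1) ω, N (t + 1) ω))).comap_le
  · rw [(hid t).integral_eq, integral_sub (hL2.integrable one_le_two) (integrable_const c)]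
    simp [hc]
  · exact (((hid t).comp (measurable_id.pow_const 2)).integral_eq).le
  · filter_upwards [hWα, h.rate_sq] with ω h1 h2
    refine Summable.of_nonneg_of_le (fun t => sq_nonneg _) (fun t => ?_) h2
    rw [← sq_abs]
    exact pow_le_pow_left₀ (abs_nonneg _) (h1 t) 2

variable {Q0 : Matrix (Fin n ⊕ Fin m) (Fin n ⊕ Fin m) ℝ}

theorem measurable_qSeq (h : IsModel μ A N α) (t : ℕ) :
    Measurable[pastSigma A N t] (qSeq A N α Q0 t) := by
  induction t with
  | zero => exact measurable_const
  | succ t ih =>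
    have hQ : Measurable[pastSigma A N (t + 1)] (qSeq A N α Q0 t) :=
      ih.mono (h.filtration.mono (Nat.le_succ t)) le_rfl
    have hα : Measurable[pastSigma A N (t + 1)] (α t) :=
      (h.meas_rate t).mono (h.filtration.mono (Nat.le_succ t)) le_rfl
    have hξ := measurable_pair_past (A := A) (N := N) (Nat.le_add_left 1 t) le_rfl
    have hPi := measurable_ricPi.comp hQ
    have hc : Continuous fun x : (ℝ × Matrix (Fin n ⊕ Fin m) (Fin n ⊕ Fin m) ℝ) ×
        (Matrix (Fin n) (Fin n ⊕ Fin m) ℝ × Matrix (Fin n ⊕ Fin m) (Fin n ⊕ Fin m) ℝ) ×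
          Matrix (Fin n) (Fin n) ℝ =>
        x.1.2 + x.1.1 • (x.2.1.2 + (x.2.1.1)ᵀ * x.2.2 * x.2.1.1 - x.1.2) := by
      fun_prop
    exact hc.measurable.comp ((hα.prodMk hQ).prodMk (hξ.prodMk hPi))

theorem measurable_runMax_qSeq (h : IsModel μ A N α) (t : ℕ) :
    Measurable[pastSigma A N t] fun ω => runMax (fun s => (qSeq A N α Q0 s ω).trace) t := by
  have htr : Continuous fun X : Matrix (Fin n ⊕ Fin m) (Fin n ⊕ Fin m) ℝ => X.trace :=
    continuous_id.matrix_trace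
  have hT : ∀ t, Measurable[pastSigma A N t] fun ω => (qSeq A N α Q0 t ω).trace := fun t =>
    htr.measurable.comp (h.measurable_qSeq t)
  induction t with
  | zero => exact measurable_const.max (hT 0)
  | succ t ih => exact (ih.mono (h.filtration.mono (Nat.le_succ t)) le_rfl).max (hT (t + 1))

theorem ae_posSemidef_qSeq (h : IsModel μ A N α) (hQ0 : Q0.PosSemidef) :
    ∀ᵐ ω ∂μ, ∀ t, (qSeq A N α Q0 t ω).PosSemidef := by
  have hN : ∀ᵐ ω ∂μ, ∀ t, (N (t + 1) ω).PosSemidef :=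
    ae_all_iff.2 fun t => h.psd_N _ (Nat.le_add_left 1 t)
  filter_upwards [hN, h.rate_mem] with ω hN hα t
  induction t with
  | zero => exact hQ0
  | succ t ih =>
    have e : qSeq A N α Q0 (t + 1) ω = (1 - α t ω) • qSeq A N α Q0 t ω
        + α t ω • (N (t + 1) ω + (A (t + 1) ω)ᵀ * ricPi (qSeq A N α Q0 t ω) * A (t + 1) ω) := by
      rw [qSeq]
      module
    rw [e]
    have h1 := (posSemidef_ricPi ih).conjTranspose_mul_mul_same (A (t + 1) ω)
    rw [Matrix.conjTranspose_eq_transpose_of_trivial] at h1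
    exact (ih.smul (sub_nonneg.2 (hα t).2)).add (((hN t).add h1).smul (hα t).1)

/-- The normalized noise of the recursion. -/
def normalizedNoise (μ : Measure Ω) (A : ℕ → Ω → Matrix (Fin n) (Fin n ⊕ Fin m) ℝ)
    (N : ℕ → Ω → Matrix (Fin n ⊕ Fin m) (Fin n ⊕ Fin m) ℝ) (α : ℕ → Ω → ℝ)
    (Q0 : Matrix (Fin n ⊕ Fin m) (Fin n ⊕ Fin m) ℝ) (t : ℕ) (ω : Ω) :
    Matrix (Fin n ⊕ Fin m) (Fin n ⊕ Fin m) ℝ :=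
  (α t ω / runMax (fun s => (qSeq A N α Q0 s ω).trace) t) •
    (N (t + 1) ω + (A (t + 1) ω)ᵀ * ricPi (qSeq A N α Q0 t ω) * A (t + 1) ω
      - meanRiccati μ (A 1) (N 1) (qSeq A N α Q0 t ω))

/-- Each entry is a finite combination of scalar series driven by entries of `N` and products of
entries of `A`. The weights involve only the past, and `|Π(Q)_kl| ≤ tr Π(Q) ≤ tr Q ≤ R` keeps them
below `α`. -/
theorem ae_tendsto_sum_normalizedNoise [IsProbabilityMeasure μ] (h : IsModel μ A N α)
    (hQ0 : Q0.PosSemidef) :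
    ∀ᵐ ω ∂μ, ∃ l, Tendsto
      (fun T => ∑ t ∈ Finset.range T, normalizedNoise μ A N α Q0 t ω) atTop (𝓝 l) := by
  set R : ℕ → Ω → ℝ := fun t ω => runMax (fun s => (qSeq A N α Q0 s ω).trace) t with hR
  have hR1 : ∀ t ω, 1 ≤ R t ω := fun t ω => one_le_runMax _ t
  have hN : ∀ᵐ ω ∂μ, ∀ i j, ∃ l : ℝ, Tendsto (fun T => ∑ t ∈ Finset.range T,
      (α t ω / R t ω) * (N (t + 1) ω i j - ∫ ω, N 1 ω i j ∂μ)) atTop (𝓝 l) := by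
    refine ae_all_iff.2 fun i => ae_all_iff.2 fun j => ?_
    refine h.ae_tendsto_sum_noise (φ := fun x => x.2 i j)
      ((measurable_pi_apply j).comp ((measurable_pi_apply i).comp measurable_snd)) (h.memLp_N i j)
      (fun t => (h.meas_rate t).div (h.measurable_runMax_qSeq t)) ?_
    filter_upwards [h.rate_mem] with ω hα t
    rw [abs_of_nonneg (div_nonneg (hα t).1 (zero_le_one.trans (hR1 t ω)))]
    exact div_le_self (hα t).1 (hR1 t ω)
  have hA : ∀ᵐ ω ∂μ, ∀ i j k l, ∃ x : ℝ, Tendsto (fun T => ∑ t ∈ Finset.range T,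
      (α t ω * ricPi (qSeq A N α Q0 t ω) k l / R t ω) *
        (A (t + 1) ω k i * A (t + 1) ω l j - ∫ ω, A 1 ω k i * A 1 ω l j ∂μ)) atTop (𝓝 x) := by
    refine ae_all_iff.2 fun i => ae_all_iff.2 fun j => ae_all_iff.2 fun k =>
      ae_all_iff.2 fun l => ?_
    have hent : ∀ k i, Measurable fun x : Matrix (Fin n) (Fin n ⊕ Fin m) ℝ ×
        Matrix (Fin n ⊕ Fin m) (Fin n ⊕ Fin m) ℝ => x.1 k i := fun k i =>
      (measurable_pi_apply i).comp ((measurable_pi_apply k).comp measurable_fst)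
    refine h.ae_tendsto_sum_noise (φ := fun x => x.1 k i * x.1 l j)
      ((hent k i).mul (hent l j)) (h.memLp_A k l i j) (fun t => ?_) ?_
    · exact ((h.meas_rate t).mul ((measurable_pi_apply l).comp ((measurable_pi_apply k).comp
        (measurable_ricPi.comp (h.measurable_qSeq t))))).div (h.measurable_runMax_qSeq t)
    · filter_upwards [h.rate_mem, h.ae_posSemidef_qSeq hQ0] with ω hα hQ t
      have hR0 : 0 < R t ω := zero_lt_one.trans_le (hR1 t ω)
      have hPi : |ricPi (qSeq A N α Q0 t ω) k l| ≤ R t ω :=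
        (abs_apply_le_trace (posSemidef_ricPi (hQ t)) k l).trans
          ((trace_ricPi_le (hQ t)).trans (le_runMax (fun s => (qSeq A N α Q0 s ω).trace) t))
      rw [abs_div, abs_mul, abs_of_nonneg (hα t).1, abs_of_pos hR0, div_le_iff₀ hR0]
      exact mul_le_mul_of_nonneg_left hPi (hα t).1
  filter_upwards [hN, hA] with ω hN hA
  choose x hx using hN
  choose y hy using hA
  refine ⟨Matrix.of fun i j => x i j + ∑ l, ∑ k, y i j k l, ?_⟩
  refine tendsto_pi_nhds.2 fun i => tendsto_pi_nhds.2 fun j => ?_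
  have hlim := (hx i j).add (tendsto_finsetSum Finset.univ fun l _ =>
    tendsto_finsetSum Finset.univ fun k _ => hy i j k l)
  refine hlim.congr fun T => ?_
  rw [Matrix.sum_apply]
  simp_rw [Finset.sum_comm (t := Finset.range T)]
  rw [← Finset.sum_add_distrib]
  refine Finset.sum_congr rfl fun t _ => ?_
  rw [normalizedNoise, Matrix.smul_apply, Matrix.sub_apply, Matrix.add_apply, meanRiccati,
    Matrix.add_apply, h.matExp_conj_apply, transpose_mul_mul_apply, matExp, Matrix.of_apply,
    smul_eq_mul]
  have e : ∀ (a b c : ℝ) (u v : Fin n → Fin n → ℝ), a * (b + ∑ l, ∑ k, u l k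
      - (c + ∑ l, ∑ k, v l k)) = a * (b - c) + ∑ l, ∑ k, a * (u l k - v l k) := by
    intro a b c u v
    simp only [← Finset.mul_sum, Finset.sum_sub_distrib]
    ring
  rw [e]
  congr 1
  refine Finset.sum_congr rfl fun l _ => Finset.sum_congr rfl fun k _ => ?_
  ring

theorem ae_isNoisyAverage [IsProbabilityMeasure μ] (h : IsModel μ A N α) (hQ0 : Q0.PosSemidef) :
    ∀ᵐ ω ∂μ, IsNoisyAverage (fun t => α t ω)
      (runMax fun t => (qSeq A N α Q0 t ω).trace)
      (fun t => normalizedNoise μ A N α Q0 t ω)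
      (fun t => meanRiccati μ (A 1) (N 1) (qSeq A N α Q0 t ω))
      (fun t => qSeq A N α Q0 t ω) := by
  have hN : ∀ᵐ ω ∂μ, ∀ t, (N (t + 1) ω).PosSemidef :=
    ae_all_iff.2 fun t => h.psd_N _ (Nat.le_add_left 1 t)
  filter_upwards [hN, h.rate_mem, h.rate_sum, h.ae_posSemidef_qSeq hQ0,
    h.ae_tendsto_sum_normalizedNoise hQ0] with ω hN hα hsum hQ hnoise
  have hE := Matrix.nonneg_iff_posSemidef.2 h.posDef_mean.posSemidef
  refine ⟨hα, hsum, monotone_runMax _, fun t => zero_le_one.trans (one_le_runMax _ t),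
    fun t => ?_, hnoise, fun t => (hQ t).1, fun t => ?_⟩
  · have h1 := (posSemidef_ricPi (hQ t)).conjTranspose_mul_mul_same (A (t + 1) ω)
    rw [Matrix.conjTranspose_eq_transpose_of_trivial] at h1
    have h2 := Matrix.nonneg_iff_posSemidef.1 (hE.trans
      (h.isRiccatiMap.le_map (Matrix.nonneg_iff_posSemidef.2 (hQ t))))
    exact ((((hN t).1.add h1.1).sub h2.1)).smul (IsSelfAdjoint.all _)
  · have hR : runMax (fun t => (qSeq A N α Q0 t ω).trace) t ≠ 0 :=
      (zero_lt_one.trans_le (one_le_runMax _ t)).ne'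
    rw [normalizedNoise, smul_smul, mul_div_cancel₀ _ hR, qSeq]
    module

/-- A bounded sequence of matrices with positive semidefinite terms has bounded running trace. -/
theorem runMax_le_of_norm_le {p : Type*} [Fintype p] [DecidableEq p] {Q : ℕ → Matrix p p ℝ}
    (hQ : ∀ t, (Q t).PosSemidef) {C : ℝ} (hC : ∀ t, ‖Q t‖ ≤ C) (t : ℕ) :
    runMax (fun t => (Q t).trace) t ≤ max 1 (Fintype.card p * C) :=
  runMax_le (fun t => (trace_le_card_mul_norm (hQ t).1).trans
    (mul_le_mul_of_nonneg_left (hC t) (Nat.cast_nonneg _))) t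

/-- Either the mean Riccati map has a fixed point, to which almost every path converges, or almost
no path is bounded. -/
theorem dichotomy [IsProbabilityMeasure μ] (h : IsModel μ A N α) (hQ0 : Q0.PosSemidef) :
    (∃ P : Matrix (Fin n ⊕ Fin m) (Fin n ⊕ Fin m) ℝ, P.PosSemidef ∧
      ∀ᵐ ω ∂μ, Tendsto (fun t => qSeq A N α Q0 t ω) atTop (𝓝 P)) ∨
    ∀ᵐ ω ∂μ, ω ∉ boundedEvent (qSeq A N α Q0) := by
  -- The case split does not involve `ω`, which is what makes the probability `0` or `1` and the
  -- limit deterministic.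
  by_cases hfix : ∃ P, 0 ≤ P ∧ meanRiccati μ (A 1) (N 1) P = P
  · obtain ⟨P, hP0, hP⟩ := hfix
    refine Or.inl ⟨P, Matrix.nonneg_iff_posSemidef.1 hP0, ?_⟩
    filter_upwards [h.ae_isNoisyAverage hQ0, h.ae_posSemidef_qSeq hQ0] with ω hω hQ
    exact h.isRiccatiMap.tendsto_of_fixedPoint
      (fun t => Matrix.nonneg_iff_posSemidef.2 (hQ t)) hω hP0 hP
  · refine Or.inr ?_
    filter_upwards [h.ae_isNoisyAverage hQ0, h.ae_posSemidef_qSeq hQ0] with ω hω hQ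
    rintro ⟨C, hC⟩
    exact hfix (h.isRiccatiMap.exists_fixedPoint
      (fun t => Matrix.nonneg_iff_posSemidef.2 (hQ t)) hω (runMax_le_of_norm_le hQ hC))

end IsModel

/-! ### From the dichotomy to the statement on probabilities. -/

theorem mem_boundedEvent_of_tendsto {Ω p : Type*} [Fintype p] [DecidableEq p]
    {Q : ℕ → Ω → Matrix p p ℝ} {ω : Ω} {L : Matrix p p ℝ}
    (h : Tendsto (fun t => Q t ω) atTop (𝓝 L)) : ω ∈ boundedEvent Q := by
  obtain ⟨C, hC⟩ := h.norm.bddAbove_range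
  exact ⟨C, fun t => hC (Set.mem_range_self t)⟩

end QLearningLQ

end

theorem mainTheorem2 {Ω : Type*} [MeasurableSpace Ω] (μ : Measure Ω) [IsProbabilityMeasure μ]
    (n m : ℕ)
    (A : ℕ → Ω → Matrix (Fin n) (Fin n ⊕ Fin m) ℝ)
    (N : ℕ → Ω → Matrix (Fin n ⊕ Fin m) (Fin n ⊕ Fin m) ℝ)
    (hA_meas : ∀ t, 1 ≤ t → Measurable (A t))
    (hN_meas : ∀ t, 1 ≤ t → Measurable (N t))
    (h_indep : iIndepFun (fun (t : ℕ) (ω : Ω) => (A (t + 1) ω, N (t + 1) ω)) μ)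
    (h_ident : ∀ t, 1 ≤ t →
      IdentDistrib (fun ω => (A t ω, N t ω)) (fun ω => (A 1 ω, N 1 ω)) μ μ)
    (hN_psd : ∀ t, 1 ≤ t → ∀ᵐ ω ∂μ, (N t ω).PosSemidef)
    (h_moment : Integrable (fun ω => ‖N 1 ω‖ ^ 2 + ‖(A 1 ω)ᵀ * A 1 ω‖ ^ 2) μ)
    (hN_mean : (QLearningLQ.matExp μ (N 1)).PosDef)
    (α : ℕ → Ω → ℝ)
    (hα_meas : ∀ t, Measurable[QLearningLQ.pastSigma A N t] (α t))
    (hα_mem : ∀ᵐ ω ∂μ, ∀ t, α t ω ∈ Set.Icc (0 : ℝ) 1)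
    (hα_sum : ∀ᵐ ω ∂μ, Tendsto (fun T => ∑ t ∈ Finset.range T, α t ω) atTop atTop)
    (hα_sq : ∀ᵐ ω ∂μ, Summable (fun t => α t ω ^ 2))
    (Q0 : Matrix (Fin n ⊕ Fin m) (Fin n ⊕ Fin m) ℝ) (hQ0 : Q0.PosSemidef) :
    (μ (QLearningLQ.boundedEvent (QLearningLQ.qSeq A N α Q0)) = 0 ∨
      μ (QLearningLQ.boundedEvent (QLearningLQ.qSeq A N α Q0)) = 1) ∧
    (μ (QLearningLQ.boundedEvent (QLearningLQ.qSeq A N α Q0)) = 1 →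
      ∃ Qs : Matrix (Fin n ⊕ Fin m) (Fin n ⊕ Fin m) ℝ, Qs.PosSemidef ∧
        ∀ᵐ ω ∂μ, Tendsto (fun t => QLearningLQ.qSeq A N α Q0 t ω) atTop (𝓝 Qs)) ∧
    (μ (QLearningLQ.boundedEvent (QLearningLQ.qSeq A N α Q0)) = 0 →
      ∀ᵐ ω ∂μ, ¬ ∃ L : Matrix (Fin n ⊕ Fin m) (Fin n ⊕ Fin m) ℝ,
        Tendsto (fun t => QLearningLQ.qSeq A N α Q0 t ω) atTop (𝓝 L)) := by
  have h : QLearningLQ.IsModel μ A N α := ⟨hA_meas, hN_meas, h_indep, h_ident, hN_psd, h_moment,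
    hN_mean, hα_meas, hα_mem, hα_sum, hα_sq⟩
  have hdiv : μ (QLearningLQ.boundedEvent (QLearningLQ.qSeq A N α Q0)) = 0 →
      ∀ᵐ ω ∂μ, ¬ ∃ L : Matrix (Fin n ⊕ Fin m) (Fin n ⊕ Fin m) ℝ,
        Tendsto (fun t => QLearningLQ.qSeq A N α Q0 t ω) atTop (𝓝 L) := fun h0 => by
    filter_upwards [measure_eq_zero_iff_ae_notMem.1 h0] with ω hω
    rintro ⟨L, hL⟩
    exact hω (QLearningLQ.mem_boundedEvent_of_tendsto hL)
  rcases h.dichotomy hQ0 with ⟨P, hP, hlim⟩ | hunb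
  · refine ⟨Or.inr ?_, fun _ => ⟨P, hP, hlim⟩, hdiv⟩
    refine le_antisymm prob_le_one ?_
    have hall : ∀ᵐ ω ∂μ, ω ∈ QLearningLQ.boundedEvent (QLearningLQ.qSeq A N α Q0) :=
      hlim.mono fun ω hω => QLearningLQ.mem_boundedEvent_of_tendsto hω
    -- Almost sure inclusion of the whole space suffices, so measurability of the bounded event is
    -- not needed.
    have := measure_mono_ae (μ := μ) (s := Set.univ) (hall.mono fun ω hω _ => hω)
    rwa [measure_univ] at this
  · have h0 := measure_eq_zero_iff_ae_notMem.2 hunb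
    exact ⟨Or.inl h0, fun h1 => absurd (h0.symm.trans h1) zero_ne_one, hdiv⟩
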